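/- (Chevalley–Shephard–Todd theorem, part II.) Let $V$ be a finite-dimensional complex vector space of dimension $n$, and let $G\subset GL(V)$ be a complex reflection group, i.e. a finite subgroup generated by complex reflections (diagonalizable elements $g\in GL(V)$ with $\operatorname{rank}(g-1)=1$). Let $\mathbb{C}[V]$ be the algebra of polynomial functions on $V$, graded by degree, on which $G$ acts by $(gf)(v)=f(g^{-1}v)$, and let $\mathbb{C}[V]^G$ be the subalgebra of invariants. (1) For every irreducible complex representation $\rho$ of $G$, the $\mathbb{C}[V]^G$-module $\mathrm{Hom}_G(\rho,\mathbb{C}[V])$ is free of finite rank $\dim\rho$. (2) $\mathbb{C}[V]^G$ is generated by $n$ algebraically independent homogeneous elements. For any such generators $f_1,\dots,f_n$, of degrees $d_1,\dots,d_n$, put $R_0:=\mathbb{C}[V]/(f_1,\dots,f_n)$, with the induced $G$-action and grading $R_0=\bigoplus_{N\ge 0}R_0[N]$. Then (a) the $G$-module $R_0$ is isomorphic to the regular representation of $G$; (b) $\prod_{i=1}^n d_i=|G|$; (c) the Hilbert polynomial of $R_0$ is $$\sum_{N\ge 0}\dim R_0[N]\,q^N=\prod_{i=1}^n [d_i]_q,\qquad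 [d]_q:=1+q+\dots+q^{d-1}.$$ -/

import Mathlib

open Module Polynomial

noncomputable section

namespace CST

universe u

variable {V : Type u} [AddCommGroup V] [Module ℂ V]

/-- `g` is a complex reflection: it is diagonalizable (its eigenspaces span `V`) and
`g - 1` has rank one. -/
structure IsComplexReflection (g : V ≃ₗ[ℂ] V) : Prop where
  diagonalizable : (⨆ μ : ℂ, End.eigenspace (g : End ℂ V) μ) = ⊤
  rank_sub_one : finrank ℂ (LinearMap.range ((g : End ℂ V) - 1)) = 1

/-- A complex reflection group is a finite subgroup of `GL(V)` generated by complex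
reflections. -/
structure IsComplexReflectionGroup (G : Subgroup (V ≃ₗ[ℂ] V)) : Prop where
  finite : Finite G
  generated : Subgroup.closure {g : V ≃ₗ[ℂ] V | g ∈ G ∧ IsComplexReflection g} = G

variable (V) in
/-- The algebra `ℂ[V]` of polynomial functions on `V`, as the symmetric algebra of the dual
space. -/
abbrev PolyAlg : Type u := SymmetricAlgebra ℂ (Dual ℂ V)

variable (V) in
/-- The homogeneous polynomials of degree `N`: the span of the products of `N` linear forms. -/
def homogeneousPart (N : ℕ) : Submodule ℂ (PolyAlg V) :=
  LinearMap.range (SymmetricAlgebra.ι ℂ (Dual ℂ V)) ^ N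

/-- The automorphism `f ↦ f ∘ g⁻¹` of `ℂ[V]`: the algebra map that extends `ℓ ↦ ℓ ∘ g⁻¹` on
linear forms. -/
def polyAct (g : V ≃ₗ[ℂ] V) : PolyAlg V →ₐ[ℂ] PolyAlg V :=
  SymmetricAlgebra.lift
    (SymmetricAlgebra.ι ℂ (Dual ℂ V) ∘ₗ Module.Dual.transpose (R := ℂ) ((g⁻¹ : V ≃ₗ[ℂ] V) : End ℂ V))

theorem polyAct_ι (g : V ≃ₗ[ℂ] V) (l : Dual ℂ V) :
    polyAct g (SymmetricAlgebra.ι ℂ (Dual ℂ V) l) =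
      SymmetricAlgebra.ι ℂ (Dual ℂ V) (l ∘ₗ ((g⁻¹ : V ≃ₗ[ℂ] V) : End ℂ V)) := by
  simp [polyAct, SymmetricAlgebra.lift_ι_apply, Module.Dual.transpose_apply]

theorem polyAct_one : polyAct (1 : V ≃ₗ[ℂ] V) = AlgHom.id ℂ (PolyAlg V) := by
  apply SymmetricAlgebra.algHom_ext
  refine LinearMap.ext fun l => ?_
  change polyAct 1 (SymmetricAlgebra.ι ℂ (Dual ℂ V) l) = SymmetricAlgebra.ι ℂ (Dual ℂ V) l
  rw [polyAct_ι]
  rfl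

theorem polyAct_mul (g h : V ≃ₗ[ℂ] V) : polyAct (g * h) = (polyAct g).comp (polyAct h) := by
  apply SymmetricAlgebra.algHom_ext
  refine LinearMap.ext fun l => ?_
  change polyAct (g * h) (SymmetricAlgebra.ι ℂ (Dual ℂ V) l) =
    polyAct g (polyAct h (SymmetricAlgebra.ι ℂ (Dual ℂ V) l))
  rw [polyAct_ι, polyAct_ι, polyAct_ι, mul_inv_rev]
  rfl

/-- The representation of `G ⊆ GL(V)` on `ℂ[V]`. -/
def polyRep (G : Subgroup (V ≃ₗ[ℂ] V)) : Representation ℂ G (PolyAlg V) where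
  toFun g := (polyAct (g : V ≃ₗ[ℂ] V)).toLinearMap
  map_one' := by rw [Subgroup.coe_one, polyAct_one]; rfl
  map_mul' g h := by rw [Subgroup.coe_mul, polyAct_mul]; rfl

/-- The algebra of invariants `ℂ[V]^G`. -/
def invariantAlg (G : Subgroup (V ≃ₗ[ℂ] V)) : Subalgebra ℂ (PolyAlg V) where
  carrier := {f | ∀ g ∈ G, polyAct g f = f}
  mul_mem' ha hb g hg := by rw [map_mul, ha g hg, hb g hg]
  add_mem' ha hb g hg := by rw [map_add, ha g hg, hb g hg]
  algebraMap_mem' r g _ := (polyAct g).commutes r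

/-- `Hom_G(ρ, ℂ[V])`, the `G`-equivariant linear maps from `ρ` to `ℂ[V]`, as a module over
`ℂ[V]^G` acting by multiplication on the values. -/
def equivariantHom (G : Subgroup (V ≃ₗ[ℂ] V)) {W : Type*} [AddCommGroup W] [Module ℂ W]
    (ρ : Representation ℂ G W) : Submodule (invariantAlg G) (W →ₗ[ℂ] PolyAlg V) where
  carrier := {φ | ∀ (g : G) (w : W), φ (ρ g w) = polyRep G g (φ w)}
  zero_mem' g w := by simp
  add_mem' ha hb g w := by simp [ha g w, hb g w]
  smul_mem' c φ hφ g w := by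
    have hc : polyAct (g : V ≃ₗ[ℂ] V) (c : PolyAlg V) = c := c.2 g g.2
    have h : ∀ x : PolyAlg V, polyRep G g (c • x) = c • polyRep G g x := fun x => by
      change polyAct (g : V ≃ₗ[ℂ] V) ((c : PolyAlg V) * x) = (c : PolyAlg V) * polyAct (g : V ≃ₗ[ℂ] V) x
      rw [map_mul, hc]
    rw [LinearMap.smul_apply, LinearMap.smul_apply, hφ g w, h]

/-- `f₁, …, fₙ` are homogeneous, algebraically independent generators of `ℂ[V]^G`, of degrees
`d₁, …, dₙ`. -/
structure IsBasicInvariants (G : Subgroup (V ≃ₗ[ℂ] V)) {n : ℕ} (f : Fin n → PolyAlg V)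
    (d : Fin n → ℕ) : Prop where
  homogeneous : ∀ i, f i ∈ homogeneousPart V (d i)
  algebraicIndependent : AlgebraicIndependent ℂ f
  adjoin_eq : Algebra.adjoin ℂ (Set.range f) = invariantAlg G

theorem IsBasicInvariants.polyAct_eq {G : Subgroup (V ≃ₗ[ℂ] V)} {n : ℕ} {f : Fin n → PolyAlg V}
    {d : Fin n → ℕ} (h : IsBasicInvariants G f d) (g : G) (i : Fin n) :
    polyAct (g : V ≃ₗ[ℂ] V) (f i) = f i := by
  have hi : f i ∈ invariantAlg G := h.adjoin_eq ▸ Algebra.subset_adjoin ⟨i, rfl⟩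
  exact hi g g.2

/-- The algebra `R₀ = ℂ[V]/(f₁, …, fₙ)`. -/
abbrev Coinv {n : ℕ} (f : Fin n → PolyAlg V) : Type u :=
  PolyAlg V ⧸ Ideal.span (Set.range f)

/-- The degree `N` component `R₀[N]`: the image of the homogeneous polynomials of degree `N`. -/
def coinvPart {n : ℕ} (f : Fin n → PolyAlg V) (N : ℕ) : Submodule ℂ (Coinv f) :=
  (homogeneousPart V N).map (Ideal.Quotient.mkₐ ℂ (Ideal.span (Set.range f))).toLinearMap

theorem span_le_comap {G : Subgroup (V ≃ₗ[ℂ] V)} {n : ℕ} {f : Fin n → PolyAlg V}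
    {d : Fin n → ℕ} (h : IsBasicInvariants G f d) (g : G) :
    Ideal.span (Set.range f) ≤ (Ideal.span (Set.range f)).comap (polyAct (g : V ≃ₗ[ℂ] V)) := by
  rw [Ideal.span_le]
  rintro _ ⟨i, rfl⟩
  change polyAct (g : V ≃ₗ[ℂ] V) (f i) ∈ Ideal.span (Set.range f)
  rw [h.polyAct_eq g i]
  exact Ideal.subset_span ⟨i, rfl⟩

/-- The representation of `G` on `R₀` induced by the one on `ℂ[V]`. -/
def coinvRep {G : Subgroup (V ≃ₗ[ℂ] V)} {n : ℕ} {f : Fin n → PolyAlg V} {d : Fin n → ℕ}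
    (h : IsBasicInvariants G f d) : Representation ℂ G (Coinv f) where
  toFun g := (Ideal.quotientMapₐ (Ideal.span (Set.range f)) (polyAct (g : V ≃ₗ[ℂ] V))
    (span_le_comap h g)).toLinearMap
  map_one' := by
    refine LinearMap.ext fun x => ?_
    obtain ⟨x, rfl⟩ := Ideal.Quotient.mk_surjective x
    change Ideal.Quotient.mk _ (polyAct ((1 : G) : V ≃ₗ[ℂ] V) x) = Ideal.Quotient.mk _ x
    rw [Subgroup.coe_one, polyAct_one]; rfl
  map_mul' a b := by
    refine LinearMap.ext fun x => ?_
    obtain ⟨x, rfl⟩ := Ideal.Quotient.mk_surjective x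
    change Ideal.Quotient.mk _ (polyAct ((a * b : G) : V ≃ₗ[ℂ] V) x) =
      Ideal.Quotient.mk _ (polyAct (a : V ≃ₗ[ℂ] V) (polyAct (b : V ≃ₗ[ℂ] V) x))
    rw [Subgroup.coe_mul, polyAct_mul]; rfl

/-- The Hilbert series `∑_N dim R₀[N] q^N`. -/
def hilbertSeries {n : ℕ} (f : Fin n → PolyAlg V) : PowerSeries ℤ :=
  PowerSeries.mk fun N => (finrank ℂ (coinvPart f N) : ℤ)

/-- The `q`-integer `[d]_q = 1 + q + ⋯ + q^(d-1)`. -/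
def qInt (d : ℕ) : ℤ[X] := ∑ k ∈ Finset.range d, X ^ k

end CST

end

noncomputable section

namespace CST

universe u

section

variable {V : Type u} [AddCommGroup V] [Module ℂ V]

/-! ### The grading of `ℂ[V]` -/

/-! Write S for `ℂ[V]`, R for the invariants, 𝔪 for the ideal generated by the linear forms and I
for the Hilbert ideal, generated by the homogeneous invariants of positive degree. Everything rests
on one consequence of being generated by reflections: for a reflection `g` with hyperplane equation
`l`, every `g s - s` is divisible by `l`. Induction on the degree then gives Chevalley's lemma
`mem_hilbertIdeal_of_mul_mem`: if `a` lies in R but not in the ideal J of R, and `a s ∈ J S` with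
`s` homogeneous, then `s ∈ I`. Its usable form is `exists_relation`: homogeneous relations with
coefficients in R, not all zero, produce a nontrivial relation modulo I with complex coefficients,
the same for a whole family of relations.

It is used twice. Applied to the partial derivatives of a relation `F(f) = 0`, and combined with
Euler's identity, it shows that homogeneous invariants independent modulo `𝔪 I` are algebraically
independent (`algebraicIndependent`). A maximal such family generates I by graded Nakayama, hence
generates R by Hilbert's averaging argument, and the transcendence degree forces its size to be n.
Applied to a homogeneous basis of a graded `G`-stable complement E of I, it shows that this basis is
independent over R; since it also spans, S is free over R with S ≅ R ⊗ E.

The representation E is then identified. Dedekind independence of the automorphisms in `G` gives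
`dim E ≤ |G|`, while restriction of functions to a free orbit maps E onto the functions on `G`. So
E, which is isomorphic to `R₀`, is regular, and `Hom_G(ρ, S)` is isomorphic to `Hom(ρ, R)`, which is
free of rank `dim ρ`. Finally S ≅ R ⊗ E multiplies Hilbert series: that of `R₀` is `∏ (1 - q^{d_i})
/ (1 - q)^n`, and `q = 1` gives `∏ d_i = |G|`. -/

instance : SetLike.GradedMonoid (homogeneousPart V) :=
  Submodule.nat_power_gradedMonoid (LinearMap.range (SymmetricAlgebra.ι ℂ (Dual ℂ V)))

variable (V) in
/-- Linear forms as elements of degree one of `⨁ N, homogeneousPart V N`. -/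
def linearFormOf : Dual ℂ V →ₗ[ℂ] DirectSum ℕ fun N => homogeneousPart V N :=
  DirectSum.lof ℂ ℕ (fun N => homogeneousPart V N) 1 ∘ₗ
    (SymmetricAlgebra.ι ℂ (Dual ℂ V)).codRestrict _ fun l => by
      simpa only [homogeneousPart, pow_one] using LinearMap.mem_range_self _ l

theorem ι_mem_homogeneousPart (l : Dual ℂ V) :
    SymmetricAlgebra.ι ℂ (Dual ℂ V) l ∈ homogeneousPart V 1 := by
  simpa only [homogeneousPart, pow_one] using LinearMap.mem_range_self _ l

theorem linearFormOf_apply (l : Dual ℂ V) :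
    linearFormOf V l = DirectSum.of (fun N => homogeneousPart V N) 1
      ⟨SymmetricAlgebra.ι ℂ (Dual ℂ V) l, ι_mem_homogeneousPart l⟩ :=
  rfl

/-- The decomposition is the algebra map that puts each linear form in degree one; both required
identities reduce to linear forms. -/
instance : GradedAlgebra (homogeneousPart V) :=
  GradedAlgebra.ofAlgHom _ (SymmetricAlgebra.lift (linearFormOf V))
    (by
      apply SymmetricAlgebra.algHom_ext
      refine LinearMap.ext fun l => ?_
      change DirectSum.coeAlgHom (homogeneousPart V) (SymmetricAlgebra.lift (linearFormOf V)
        (SymmetricAlgebra.ι ℂ (Dual ℂ V) l)) = SymmetricAlgebra.ι ℂ (Dual ℂ V) l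
      rw [SymmetricAlgebra.lift_ι_apply, linearFormOf_apply, DirectSum.coeAlgHom_of])
    fun i x => by
      obtain ⟨x, hx⟩ := x
      dsimp only
      induction hx using Submodule.pow_induction_on_left' with
      | algebraMap r =>
        rw [AlgHom.commutes, DirectSum.algebraMap_apply]; rfl
      | add x y i hx hy ihx ihy =>
        rw [map_add, ihx, ihy, ← map_add]; rfl
      | mem_mul m hm i x hx ih =>
        obtain ⟨_, rfl⟩ := hm
        rw [map_mul, ih, SymmetricAlgebra.lift_ι_apply, linearFormOf_apply, DirectSum.of_mul_of]
        exact DirectSum.of_eq_of_gradedMonoid_eq (Sigma.subtype_ext (add_comm _ _) rfl)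

theorem mem_homogeneousPart_zero {s : PolyAlg V} :
    s ∈ homogeneousPart V 0 ↔ ∃ c : ℂ, algebraMap ℂ (PolyAlg V) c = s := by
  rw [homogeneousPart, pow_zero, Submodule.mem_one]

/-- The homogeneous component of degree `N`, as a linear map. -/
def comp (N : ℕ) : PolyAlg V →ₗ[ℂ] PolyAlg V :=
  GradedAlgebra.proj (homogeneousPart V) N

theorem comp_eq (N : ℕ) (s : PolyAlg V) :
    comp N s = (DirectSum.decompose (homogeneousPart V) s N : PolyAlg V) := rfl

theorem comp_mem (N : ℕ) (s : PolyAlg V) : comp N s ∈ homogeneousPart V N :=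
  SetLike.coe_mem _

theorem comp_of_mem {N : ℕ} {s : PolyAlg V} (hs : s ∈ homogeneousPart V N) : comp N s = s :=
  DirectSum.decompose_of_mem_same _ hs

theorem comp_of_mem_of_ne {M N : ℕ} {s : PolyAlg V} (hs : s ∈ homogeneousPart V M) (h : M ≠ N) :
    comp N s = 0 :=
  DirectSum.decompose_of_mem_ne _ hs h

theorem comp_mul_right {i : ℕ} (N : ℕ) {b : PolyAlg V} (hb : b ∈ homogeneousPart V i)
    (a : PolyAlg V) : comp N (a * b) = if i ≤ N then comp (N - i) a * b else 0 :=
  DirectSum.coe_decompose_mul_of_right_mem _ N hb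

theorem comp_mul_left {i : ℕ} (N : ℕ) {a : PolyAlg V} (ha : a ∈ homogeneousPart V i)
    (b : PolyAlg V) : comp N (a * b) = if i ≤ N then a * comp (N - i) b else 0 :=
  DirectSum.coe_decompose_mul_of_left_mem _ N ha

theorem eq_zero_of_comp {s : PolyAlg V} (h : ∀ N, comp N s = 0) : s = 0 := by
  apply (DirectSum.decompose (homogeneousPart V)).injective
  rw [DirectSum.decompose_zero]
  ext N
  simpa [comp_eq] using h N

theorem mem_of_comp_mem {M : Type*} [SetLike M (PolyAlg V)] [AddSubmonoidClass M (PolyAlg V)]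
    {P : M} {s : PolyAlg V} (h : ∀ N, comp N s ∈ P) : s ∈ P := by
  classical
  rw [← DirectSum.sum_support_decompose (homogeneousPart V) s]
  exact sum_mem fun N _ => h N

theorem iSup_homogeneousPart : ⨆ N, homogeneousPart V N = ⊤ :=
  (DirectSum.Decomposition.isInternal (homogeneousPart V)).submodule_iSup_eq_top

theorem homogeneous_induction {p : PolyAlg V → Prop} (hom : ∀ N, ∀ s ∈ homogeneousPart V N, p s)
    (add : ∀ s t, p s → p t → p (s + t)) (s : PolyAlg V) : p s := by
  have hs : s ∈ ⨆ N, homogeneousPart V N := by rw [iSup_homogeneousPart]; trivial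
  exact Submodule.iSup_induction _ (motive := p) hs hom (hom 0 0 (zero_mem _)) add

theorem mul_mem_homogeneousPart {i j : ℕ} {s t : PolyAlg V} (hs : s ∈ homogeneousPart V i)
    (ht : t ∈ homogeneousPart V j) : s * t ∈ homogeneousPart V (i + j) :=
  SetLike.mul_mem_graded hs ht

/-! ### The action of `G` -/

theorem polyAct_mem {N : ℕ} {s : PolyAlg V} (g : V ≃ₗ[ℂ] V) (hs : s ∈ homogeneousPart V N) :
    polyAct g s ∈ homogeneousPart V N := by
  have h : (homogeneousPart V N).map (polyAct g).toLinearMap ≤ homogeneousPart V N := by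
    rw [homogeneousPart, Submodule.map_pow]
    refine pow_le_pow_left' ?_ N
    rintro _ ⟨_, ⟨l, rfl⟩, rfl⟩
    exact ⟨_, (polyAct_ι g l).symm⟩
  exact h ⟨s, hs, rfl⟩

theorem comp_polyAct (N : ℕ) (g : V ≃ₗ[ℂ] V) (s : PolyAlg V) :
    comp N (polyAct g s) = polyAct g (comp N s) := by
  induction s using homogeneous_induction with
  | hom M s hs =>
    by_cases h : M = N
    · subst h
      rw [comp_of_mem hs, comp_of_mem (polyAct_mem g hs)]
    · rw [comp_of_mem_of_ne hs h, comp_of_mem_of_ne (polyAct_mem g hs) h, map_zero]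
  | add s t hs ht => simp only [map_add, hs, ht]

theorem comp_mem_invariantAlg {G : Subgroup (V ≃ₗ[ℂ] V)} {s : PolyAlg V}
    (hs : s ∈ invariantAlg G) (N : ℕ) : comp N s ∈ invariantAlg G := fun g hg => by
  rw [← comp_polyAct, hs g hg]

theorem polyAct_mul_apply (g h : V ≃ₗ[ℂ] V) (s : PolyAlg V) :
    polyAct (g * h) s = polyAct g (polyAct h s) := by
  rw [polyAct_mul]; rfl

theorem polyAct_one_apply (s : PolyAlg V) : polyAct (1 : V ≃ₗ[ℂ] V) s = s := by
  rw [polyAct_one]; rfl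

/-- The average over `G`. -/
def reynolds (G : Subgroup (V ≃ₗ[ℂ] V)) [Fintype G] : PolyAlg V →ₗ[ℂ] PolyAlg V :=
  (Fintype.card G : ℂ)⁻¹ • ∑ g : G, (polyAct (g : V ≃ₗ[ℂ] V)).toLinearMap

variable {G : Subgroup (V ≃ₗ[ℂ] V)}

section Reynolds

variable [Fintype G]

theorem reynolds_apply (s : PolyAlg V) :
    reynolds G s = (Fintype.card G : ℂ)⁻¹ • ∑ g : G, polyAct (g : V ≃ₗ[ℂ] V) s := by
  simp [reynolds]

theorem sum_polyAct_mem (s : PolyAlg V) :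
    ∑ g : G, polyAct (g : V ≃ₗ[ℂ] V) s ∈ invariantAlg G := fun g hg => by
  rw [map_sum]
  simp_rw [← polyAct_mul_apply]
  exact Fintype.sum_equiv (Equiv.mulLeft (⟨g, hg⟩ : G)) _ _ fun _ => rfl

theorem reynolds_mem (s : PolyAlg V) : reynolds G s ∈ invariantAlg G := by
  rw [reynolds_apply]
  exact Subalgebra.smul_mem _ (sum_polyAct_mem s) _

theorem reynolds_mul {r : PolyAlg V} (hr : r ∈ invariantAlg G) (s : PolyAlg V) :
    reynolds G (r * s) = r * reynolds G s := by
  rw [reynolds_apply, reynolds_apply, mul_smul_comm, Finset.mul_sum]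
  congr 1
  exact Finset.sum_congr rfl fun g _ => by rw [map_mul, hr g g.2]

theorem reynolds_of_mem {r : PolyAlg V} (hr : r ∈ invariantAlg G) : reynolds G r = r := by
  rw [reynolds_apply, Finset.sum_congr rfl fun (g : G) _ => hr g g.2, Finset.sum_const,
    Finset.card_univ, ← Nat.cast_smul_eq_nsmul ℂ, smul_smul,
    inv_mul_cancel₀ (Nat.cast_ne_zero.2 Fintype.card_ne_zero), one_smul]

theorem reynolds_mem_homogeneousPart {N : ℕ} {s : PolyAlg V} (hs : s ∈ homogeneousPart V N) :
    reynolds G s ∈ homogeneousPart V N := by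
  rw [reynolds_apply]
  exact Submodule.smul_mem _ _ (Submodule.sum_mem _ fun g _ => polyAct_mem _ hs)

end Reynolds

/-! ### The Hilbert ideal -/

variable (G) in
/-- The homogeneous invariants of positive degree. -/
def positiveInvariants : Set (PolyAlg V) :=
  {r | r ∈ invariantAlg G ∧ ∃ N, 0 < N ∧ r ∈ homogeneousPart V N}

variable (G) in
/-- The ideal of `ℂ[V]` generated by the homogeneous invariants of positive degree. -/
def hilbertIdeal : Ideal (PolyAlg V) := Ideal.span (positiveInvariants G)

theorem polyAct_mem_hilbertIdeal {g : V ≃ₗ[ℂ] V} (hg : g ∈ G) {s : PolyAlg V}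
    (hs : s ∈ hilbertIdeal G) : polyAct g s ∈ hilbertIdeal G := by
  have h : hilbertIdeal G ≤ (hilbertIdeal G).comap (polyAct g) := by
    refine Ideal.span_le.2 fun r hr => ?_
    change polyAct g r ∈ hilbertIdeal G
    rw [hr.1 g hg]
    exact Ideal.subset_span hr
  exact h hs

/-- The components of an element of an ideal generated by homogeneous elements. -/
theorem comp_mem_span_of_mem_ideal_span {T : Type*} {b : T → PolyAlg V} {deg : T → ℕ}
    (hb : ∀ t, b t ∈ homogeneousPart V (deg t)) {x : PolyAlg V}
    (hx : x ∈ Ideal.span (Set.range b)) (N : ℕ) :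
    comp N x ∈ Submodule.span ℂ {y | ∃ t, deg t ≤ N ∧
      ∃ s ∈ homogeneousPart V (N - deg t), s * b t = y} := by
  induction hx using Submodule.closure_induction with
  | zero => simp
  | add x y _ _ hx hy => rw [map_add]; exact add_mem hx hy
  | smul_mem s _ h =>
    obtain ⟨t, rfl⟩ := h
    rw [smul_eq_mul, comp_mul_right N (hb t)]
    split_ifs with h
    · exact Submodule.subset_span ⟨t, h, _, comp_mem _ _, rfl⟩
    · exact zero_mem _

variable (G) in
/-- The degree of a homogeneous invariant of positive degree. -/
def positiveInvariants.degree (r : positiveInvariants G) : ℕ := r.2.2.choose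

theorem positiveInvariants.degree_pos (r : positiveInvariants G) : 0 < degree G r :=
  r.2.2.choose_spec.1

theorem positiveInvariants.mem (r : positiveInvariants G) :
    (r : PolyAlg V) ∈ homogeneousPart V (degree G r) :=
  r.2.2.choose_spec.2

theorem comp_mem_hilbertIdeal {x : PolyAlg V} (hx : x ∈ hilbertIdeal G) (N : ℕ) :
    comp N x ∈ Submodule.span ℂ {y | ∃ r : positiveInvariants G,
      positiveInvariants.degree G r ≤ N ∧
      ∃ s ∈ homogeneousPart V (N - positiveInvariants.degree G r), s * (r : PolyAlg V) = y} :=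
  comp_mem_span_of_mem_ideal_span positiveInvariants.mem (by rwa [Subtype.range_coe])  N

theorem comp_mem_ideal_span {T : Type*} {b : T → PolyAlg V} {deg : T → ℕ}
    (hb : ∀ t, b t ∈ homogeneousPart V (deg t)) {x : PolyAlg V}
    (hx : x ∈ Ideal.span (Set.range b)) (N : ℕ) : comp N x ∈ Ideal.span (Set.range b) := by
  have : Submodule.span ℂ {y | ∃ t, deg t ≤ N ∧ ∃ s ∈ homogeneousPart V (N - deg t), s * b t = y} ≤
      (Ideal.span (Set.range b)).restrictScalars ℂ := by
    refine Submodule.span_le.2 ?_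
    rintro _ ⟨t, _, s, _, rfl⟩
    exact Ideal.mul_mem_left _ _ (Ideal.subset_span ⟨t, rfl⟩)
  exact this (comp_mem_span_of_mem_ideal_span hb hx N)

end

section

variable {V : Type u} [AddCommGroup V] [Module ℂ V] {G : Subgroup (V ≃ₗ[ℂ] V)}

/-! ### Evaluation -/

/-- Evaluation of polynomial functions at a point. -/
def evalAt (v : V) : PolyAlg V →ₐ[ℂ] ℂ :=
  SymmetricAlgebra.lift (Dual.eval ℂ V v)

theorem evalAt_ι (v : V) (l : Dual ℂ V) : evalAt v (SymmetricAlgebra.ι ℂ (Dual ℂ V) l) = l v := by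
  rw [evalAt, SymmetricAlgebra.lift_ι_apply, Dual.eval_apply]

theorem evalAt_polyAct (g : V ≃ₗ[ℂ] V) (v : V) (s : PolyAlg V) :
    evalAt v (polyAct g s) = evalAt (g⁻¹ v) s := by
  have h : (evalAt v).comp (polyAct g) = evalAt (g⁻¹ v) := by
    apply SymmetricAlgebra.algHom_ext
    refine LinearMap.ext fun l => ?_
    change evalAt v (polyAct g (SymmetricAlgebra.ι ℂ (Dual ℂ V) l)) =
      evalAt (g⁻¹ v) (SymmetricAlgebra.ι ℂ (Dual ℂ V) l)
    rw [polyAct_ι, evalAt_ι, evalAt_ι]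
    rfl
  exact DFunLike.congr_fun h s

theorem ι_ne_zero {l : Dual ℂ V} (hl : l ≠ 0) : SymmetricAlgebra.ι ℂ (Dual ℂ V) l ≠ 0 := fun h =>
  hl (LinearMap.ext fun v => by rw [← evalAt_ι, h, map_zero, LinearMap.zero_apply])

/-! ### Reflections -/

theorem exists_dual_eq_one {E : Type*} [AddCommGroup E] [Module ℂ E] {w : E} (hw : w ≠ 0) :
    ∃ μ : Dual ℂ E, μ w = 1 := by
  obtain ⟨μ, hμ⟩ : ∃ μ : Dual ℂ E, μ w ≠ 0 := by
    by_contra! h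
    exact hw ((Module.forall_dual_apply_eq_zero_iff ℂ w).1 h)
  exact ⟨(μ w)⁻¹ • μ, by simp [hμ]⟩

/-- A function and its translate by `g` agree on the fixed hyperplane of `g`, so their difference is
a multiple of the equation of that hyperplane. -/
theorem IsComplexReflection.exists_dvd {g : V ≃ₗ[ℂ] V} (hg : IsComplexReflection g) :
    ∃ l : Dual ℂ V, l ≠ 0 ∧
      ∀ s : PolyAlg V, SymmetricAlgebra.ι ℂ (Dual ℂ V) l ∣ polyAct g s - s := by
  obtain ⟨⟨w, y, hy⟩, hw0, hw⟩ := finrank_eq_one_iff'.1 hg.rank_sub_one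
  have hw0' : w ≠ 0 := fun h => hw0 (Subtype.ext h)
  obtain ⟨μ, hμ⟩ : ∃ μ : Dual ℂ V, μ w = 1 :=
    exists_dual_eq_one hw0'
  have key : ∀ x, g x - x = μ (g x - x) • w := fun x => by
    obtain ⟨c, hc⟩ := hw ⟨_, x, rfl⟩
    have hc' : c • w = g x - x := congrArg Subtype.val hc
    rw [← hc', map_smul, hμ, smul_eq_mul, mul_one]
  -- Chosen so that `g⁻¹ x = x - β x • w`: thus `l ∘ g⁻¹ = l - l w • β` for every linear form `l`,
  -- and the kernel of `β` is the fixed hyperplane.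
  let β : Dual ℂ V := (μ ∘ₗ ((g : End ℂ V) - 1)) ∘ₗ ((g⁻¹ : V ≃ₗ[ℂ] V) : End ℂ V)
  have hinv : ∀ x, g (g⁻¹ x) = x := fun x => g.apply_symm_apply x
  have hinv' : ∀ x, g⁻¹ (g x) = x := fun x => g.symm_apply_apply x
  have hβ : ∀ x, β x = μ (x - g⁻¹ x) := fun x => by
    change μ (g (g⁻¹ x) - g⁻¹ x) = _
    rw [hinv]
  refine ⟨β, fun h => ?_, fun s => ?_⟩
  · have h1 : β (g y) = 0 := by rw [h]; rfl
    have hy' : g y - y = w := hy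
    rw [hβ, hinv', hy', hμ] at h1
    exact one_ne_zero h1
  · induction s using SymmetricAlgebra.induction with
    | algebraMap r => rw [AlgHom.commutes, sub_self]; exact dvd_zero _
    | ι l =>
      have : l ∘ₗ ((g⁻¹ : V ≃ₗ[ℂ] V) : End ℂ V) = l + (-l w) • β := by
        refine LinearMap.ext fun x => ?_
        have hk := key (g⁻¹ x)
        rw [hinv, ← hβ] at hk
        have hk' : g⁻¹ x = x - β x • w := by rw [← hk]; abel
        change l (g⁻¹ x) = l x + -l w * β x
        rw [hk', map_sub, map_smul, smul_eq_mul]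
        ring
      rw [polyAct_ι, this, map_add, add_sub_cancel_left, map_smul]
      exact ⟨algebraMap ℂ _ (-l w), by rw [Algebra.smul_def, mul_comm]⟩
    | mul s t hs ht =>
      -- A twisted Leibniz rule carries divisibility from linear forms to products.
      have : polyAct g (s * t) - s * t = polyAct g s * (polyAct g t - t) + (polyAct g s - s) * t := by
        rw [map_mul]; ring
      rw [this]
      exact dvd_add (ht.mul_left _) (hs.mul_right _)
    | add s t hs ht =>
      have : polyAct g (s + t) - (s + t) = (polyAct g s - s) + (polyAct g t - t) := by
        rw [map_add]; ring
      rw [this]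
      exact dvd_add hs ht

/-! ### Chevalley's lemma -/

theorem mem_homogeneousPart_of_mul_mem {l s : PolyAlg V} {d : ℕ} (hl : l ∈ homogeneousPart V 1)
    (hl0 : l ≠ 0) (h : l * s ∈ homogeneousPart V (d + 1)) : s ∈ homogeneousPart V d := by
  have : comp d s = s := by
    refine mul_left_cancel₀ hl0 ?_
    have h1 := comp_mul_left (d + 1) hl s
    rw [if_pos (Nat.le_add_left 1 d), comp_of_mem h, Nat.add_sub_cancel] at h1
    exact h1.symm
  rw [← this]
  exact comp_mem _ _

/-- The extension to `ℂ[V]` of an ideal of `ℂ[V]^G`. -/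
abbrev extendIdeal (J : Ideal (invariantAlg G)) : Ideal (PolyAlg V) :=
  J.map (algebraMap (invariantAlg G) (PolyAlg V))

/-- The averaging operator is linear over the invariants, so it carries `J · ℂ[V]` into `J`. -/
theorem exists_reynolds_eq [Fintype G] {J : Ideal (invariantAlg G)} {x : PolyAlg V}
    (hx : x ∈ extendIdeal J) : ∃ j ∈ J, (j : PolyAlg V) = reynolds G x := by
  induction hx using Submodule.closure_induction with
  | zero => exact ⟨0, zero_mem _, by simp⟩
  | add x y _ _ hx hy =>
    obtain ⟨i, hi, hi'⟩ := hx
    obtain ⟨j, hj, hj'⟩ := hy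
    exact ⟨i + j, add_mem hi hj, by rw [map_add, ← hi', ← hj']; rfl⟩
  | smul_mem s b hb =>
    obtain ⟨j, hj, rfl⟩ := hb
    refine ⟨⟨_, reynolds_mem s⟩ * j, J.mul_mem_left _ hj, ?_⟩
    rw [smul_eq_mul, mul_comm s]
    change reynolds G s * (j : PolyAlg V) = reynolds G ((j : PolyAlg V) * s)
    rw [reynolds_mul j.2, mul_comm]

/-- Since `g` fixes the generators from `J`, dividing `g x - x` by `l` only affects their
coefficients, so the quotient stays in `J · ℂ[V]`. -/
theorem exists_quotient_mem {J : Ideal (invariantAlg G)} {g : V ≃ₗ[ℂ] V} (hg : g ∈ G)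
    {l : PolyAlg V} (hl : ∀ s : PolyAlg V, l ∣ polyAct g s - s) {x : PolyAlg V}
    (hx : x ∈ extendIdeal J) : ∃ t ∈ extendIdeal J, polyAct g x - x = l * t := by
  induction hx using Submodule.closure_induction with
  | zero => exact ⟨0, zero_mem _, by simp⟩
  | add x y _ _ hx hy =>
    obtain ⟨i, hi, hi'⟩ := hx
    obtain ⟨j, hj, hj'⟩ := hy
    refine ⟨i + j, add_mem hi hj, ?_⟩
    rw [mul_add, ← hi', ← hj', map_add]
    ring
  | smul_mem s b hb =>
    obtain ⟨j, hj, rfl⟩ := hb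
    obtain ⟨t, ht⟩ := hl s
    refine ⟨t * (j : PolyAlg V), Ideal.mul_mem_left _ _ (Ideal.mem_map_of_mem _ hj), ?_⟩
    change polyAct g (s * (j : PolyAlg V)) - s * (j : PolyAlg V) = _
    rw [map_mul, j.2 g hg, ← sub_mul, ht, mul_assoc]

/-- **Chevalley's lemma**: an invariant outside the ideal `J` of `ℂ[V]^G` can be multiplied into
`J · ℂ[V]` by a homogeneous polynomial only if the latter is in the Hilbert ideal. -/
theorem IsComplexReflectionGroup.mem_hilbertIdeal_of_mul_mem (hG : IsComplexReflectionGroup G)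
    {J : Ideal (invariantAlg G)} {a : invariantAlg G} (ha : a ∉ J) {d : ℕ} {s : PolyAlg V}
    (hs : s ∈ homogeneousPart V d) (h : (a : PolyAlg V) * s ∈ extendIdeal J) :
    s ∈ hilbertIdeal G := by
  have := hG.finite
  have := Fintype.ofFinite G
  induction d generalizing s with
  | zero =>
    obtain ⟨c, rfl⟩ := mem_homogeneousPart_zero.1 hs
    by_cases hc : c = 0
    · rw [hc, map_zero]; exact zero_mem _
    refine absurd ?_ ha
    obtain ⟨j, hj, hj'⟩ := exists_reynolds_eq h
    have hj2 : j = c • a := by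
      apply Subtype.ext
      rw [hj', mul_comm, ← Algebra.smul_def, map_smul, reynolds_of_mem a.2]
      rfl
    have : a = c⁻¹ • j := by rw [hj2, smul_smul, inv_mul_cancel₀ hc, one_smul]
    rw [this]
    exact Submodule.smul_of_tower_mem J _ hj
  | succ d ih =>
    -- The quotient `t = (g s - s) / l` has degree `d` and still satisfies `a t ∈ J · ℂ[V]`, so the
    -- induction hypothesis applies to it.
    have hrefl : ∀ g ∈ G, IsComplexReflection g → polyAct g s - s ∈ hilbertIdeal G := by
      intro g hg hgr
      obtain ⟨l, hl0, hl⟩ := hgr.exists_dvd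
      obtain ⟨t, ht⟩ := hl s
      obtain ⟨t', ht', htt'⟩ := exists_quotient_mem hg hl h
      have e : (a : PolyAlg V) * t = t' := by
        refine mul_left_cancel₀ (ι_ne_zero hl0) ?_
        rw [← htt', map_mul, a.2 g hg, ← mul_sub, ht]
        ring
      rw [ht]
      refine Ideal.mul_mem_left _ _ (ih ?_ (e ▸ ht'))
      refine mem_homogeneousPart_of_mul_mem (ι_mem_homogeneousPart l) (ι_ne_zero hl0) ?_
      rw [← ht]
      exact sub_mem (polyAct_mem g hs) hs
    have hall : ∀ g ∈ G, polyAct g s - s ∈ hilbertIdeal G := by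
      intro g hg
      rw [← hG.generated] at hg
      have hle : Subgroup.closure {g : V ≃ₗ[ℂ] V | g ∈ G ∧ IsComplexReflection g} ≤ G :=
        hG.generated.le
      induction hg using Subgroup.closure_induction with
      | mem g hg => exact hrefl g hg.1 hg.2
      | one => rw [polyAct_one_apply, sub_self]; exact zero_mem _
      | mul g k hg hk ihg ihk =>
        have : polyAct (g * k) s - s = polyAct g (polyAct k s - s) + (polyAct g s - s) := by
          rw [polyAct_mul_apply, map_sub]; ring
        rw [this]
        exact add_mem (polyAct_mem_hilbertIdeal (hle hg) ihk) ihg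
      | inv g hg ih =>
        have : polyAct g⁻¹ s - s = -polyAct g⁻¹ (polyAct g s - s) := by
          rw [map_sub, ← polyAct_mul_apply, inv_mul_cancel, polyAct_one_apply]; ring
        rw [this]
        exact neg_mem (polyAct_mem_hilbertIdeal (inv_mem (hle hg)) ih)
    -- Modulo the Hilbert ideal `s` is fixed by `G`, hence equal to its average, which is itself an
    -- invariant of positive degree.
    have hr : reynolds G s ∈ hilbertIdeal G :=
      Ideal.subset_span ⟨reynolds_mem s, d + 1, d.succ_pos, reynolds_mem_homogeneousPart hs⟩
    have hd : reynolds G s - s = (Fintype.card G : ℂ)⁻¹ • ∑ g : G, (polyAct (g : V ≃ₗ[ℂ] V) s - s) := by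
      rw [Finset.sum_sub_distrib, smul_sub, ← reynolds_apply, Finset.sum_const, Finset.card_univ,
        ← Nat.cast_smul_eq_nsmul ℂ, smul_smul,
        inv_mul_cancel₀ (Nat.cast_ne_zero.2 Fintype.card_ne_zero), one_smul]
    have hd' : reynolds G s - s ∈ hilbertIdeal G := by
      rw [hd]
      exact Submodule.smul_of_tower_mem _ _ (Submodule.sum_mem _ fun g _ => hall g g.2)
    have := sub_mem hr hd'
    rwa [sub_sub_cancel] at this

/-- The invariants whose components of degree less than `δ` vanish and whose component of degree
`δ` is killed by the functional `φ`. -/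
def initialIdeal (φ : PolyAlg V →ₗ[ℂ] ℂ) (δ : ℕ) : Ideal (invariantAlg G) where
  carrier := {r | (∀ N < δ, comp N (r : PolyAlg V) = 0) ∧ φ (comp δ (r : PolyAlg V)) = 0}
  zero_mem' := by simp
  add_mem' {r s} hr hs := by
    refine ⟨fun N hN => ?_, ?_⟩
    · rw [Subalgebra.coe_add, map_add, hr.1 N hN, hs.1 N hN, add_zero]
    · rw [Subalgebra.coe_add, map_add, map_add, hr.2, hs.2, add_zero]
  smul_mem' c r hr := by
    -- Allowing an arbitrary polynomial multiplier makes induction on homogeneous components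
    -- available. Only the constant term of the multiplier affects degree `δ`.
    suffices H : ∀ x : PolyAlg V, (∀ N < δ, comp N (x * (r : PolyAlg V)) = 0) ∧
        φ (comp δ (x * (r : PolyAlg V))) = 0 from
      H c
    intro x
    induction x using homogeneous_induction with
    | add s t hs ht =>
      refine ⟨fun N hN => ?_, ?_⟩
      · rw [add_mul, map_add, hs.1 N hN, ht.1 N hN, add_zero]
      · rw [add_mul, map_add, map_add, hs.2, ht.2, add_zero]
    | hom M s hs =>
      refine ⟨fun N hN => ?_, ?_⟩
      · rw [comp_mul_left N hs]
        split_ifs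
        · rw [hr.1 _ (by omega), mul_zero]
        · rfl
      · rw [comp_mul_left δ hs]
        split_ifs
        · obtain rfl | hM := Nat.eq_zero_or_pos M
          · obtain ⟨z, rfl⟩ := mem_homogeneousPart_zero.1 hs
            rw [← Algebra.smul_def, map_smul, Nat.sub_zero, hr.2, smul_zero]
          · rw [hr.1 _ (by omega), mul_zero, map_zero]
        · exact map_zero φ

/-- Homogeneous relations with coefficients in `ℂ[V]^G` give relations with complex coefficients
modulo the Hilbert ideal. -/
theorem IsComplexReflectionGroup.exists_relation (hG : IsComplexReflectionGroup G) {ι κ : Type*}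
    [Fintype ι] {a : ι → PolyAlg V} (ha : ∀ j, a j ∈ invariantAlg G) {δ : ι → ℕ}
    (haδ : ∀ j, a j ∈ homogeneousPart V (δ j)) (ha0 : ∃ j, a j ≠ 0) {u : κ → ι → PolyAlg V}
    {ν : κ → ι → ℕ} (hu : ∀ k j, u k j ∈ homogeneousPart V (ν k j)) {D : κ → ℕ}
    (hD : ∀ k j, δ j + ν k j = D k) (h : ∀ k, ∑ j, a j * u k j = 0) :
    ∃ c : ι → ℂ, (∃ j, c j ≠ 0) ∧ ∀ k, ∑ j, c j • u k j ∈ hilbertIdeal G := by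
  classical
  -- Minimality of the degree puts every `a j - c j • a i` in `initialIdeal φ (δ i)`, while `φ (a i)
  -- = 1` keeps `a i` out. The constants `c` depend only on `a` and `φ`, so they serve all `k` at
  -- once.
  obtain ⟨i, hi, hmin⟩ : ∃ i, a i ≠ 0 ∧ ∀ j, a j ≠ 0 → δ i ≤ δ j := by
    obtain ⟨i, hi, hmin⟩ := (Finset.univ.filter fun j => a j ≠ 0).exists_min_image δ
      (by obtain ⟨j, hj⟩ := ha0; exact ⟨j, by simp [hj]⟩)
    exact ⟨i, by simpa using hi, fun j hj => hmin j (by simp [hj])⟩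
  obtain ⟨φ, hφ⟩ : ∃ φ : PolyAlg V →ₗ[ℂ] ℂ, φ (a i) = 1 :=
    exists_dual_eq_one hi
  let c : ι → ℂ := fun j => φ (comp (δ i) (a j))
  have hci : c i = 1 := by simp only [c, comp_of_mem (haδ i), hφ]
  have hc : ∀ j, c j ≠ 0 → δ j = δ i := fun j hj => by
    by_contra hne
    exact hj (by simp only [c, comp_of_mem_of_ne (haδ j) hne, map_zero])
  refine ⟨c, ⟨i, by rw [hci]; exact one_ne_zero⟩, fun k => ?_⟩
  have hJ : ∀ j, (⟨a j, ha j⟩ - c j • ⟨a i, ha i⟩ : invariantAlg G) ∈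
      initialIdeal (G := G) φ (δ i) := by
    intro j
    have e : ((⟨a j, ha j⟩ - c j • ⟨a i, ha i⟩ : invariantAlg G) : PolyAlg V) =
      a j - c j • a i := rfl
    refine ⟨fun N hN => ?_, ?_⟩
    · rw [e, map_sub, map_smul, comp_of_mem_of_ne (haδ i) hN.ne', smul_zero, sub_zero]
      by_cases hj : a j = 0
      · rw [hj, map_zero]
      · exact comp_of_mem_of_ne (haδ j) (hN.trans_le (hmin j hj)).ne'
    · rw [e, map_sub, map_smul, map_sub, map_smul, comp_of_mem (haδ i), hφ, smul_eq_mul, mul_one,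
        sub_self]
  have hiJ : (⟨a i, ha i⟩ : invariantAlg G) ∉ initialIdeal (G := G) φ (δ i) := fun hm => by
    have := hm.2
    rw [comp_of_mem (haδ i), hφ] at this
    exact one_ne_zero this
  -- Only the `j` with `δ j = δ i` have `c j ≠ 0`, and for these `u k j` has degree `D k - δ i`.
  refine hG.mem_hilbertIdeal_of_mul_mem hiJ (d := D k - δ i) ?_ ?_
  · refine Submodule.sum_mem _ fun j _ => ?_
    by_cases hj : c j = 0
    · rw [hj, zero_smul]; exact zero_mem _
    · have : ν k j = D k - δ i := by rw [← hD k j, hc j hj]; omega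
      exact this ▸ Submodule.smul_mem _ _ (hu k j)
  · have e : a i * ∑ j, c j • u k j = -∑ j, (a j - c j • a i) * u k j := by
      simp only [sub_mul, Finset.sum_sub_distrib, h k, zero_sub, neg_neg, Finset.mul_sum]
      exact Finset.sum_congr rfl fun j _ => by rw [mul_smul_comm, smul_mul_assoc]
    change a i * ∑ j, c j • u k j ∈ _
    rw [e]
    exact neg_mem (Submodule.sum_mem _ fun j _ =>
      Ideal.mul_mem_right _ _ (Ideal.mem_map_of_mem (algebraMap (invariantAlg G) (PolyAlg V)) (hJ j)))

end

section

variable {V : Type u} [AddCommGroup V] [Module ℂ V] {G : Subgroup (V ≃ₗ[ℂ] V)}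

/-! ### Coordinates and partial derivatives -/

section Coordinates

variable [FiniteDimensional ℂ V]

variable (V) in
/-- A basis of the space of linear forms. -/
def coordBasis : Basis (Fin (finrank ℂ V)) ℂ (Dual ℂ V) := (finBasis ℂ V).dualBasis

variable (V) in
/-- The identification of `ℂ[V]` with a polynomial ring. -/
def polyEquiv : PolyAlg V ≃ₐ[ℂ] MvPolynomial (Fin (finrank ℂ V)) ℂ :=
  SymmetricAlgebra.equivMvPolynomial (coordBasis V)

variable (V) in
/-- The coordinate functions. -/
def coord (k : Fin (finrank ℂ V)) : PolyAlg V := SymmetricAlgebra.ι ℂ (Dual ℂ V) (coordBasis V k)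

theorem polyEquiv_coord (k : Fin (finrank ℂ V)) : polyEquiv V (coord V k) = MvPolynomial.X k :=
  SymmetricAlgebra.equivMvPolynomial_ι_apply _ _

theorem map_homogeneousPart (N : ℕ) :
    (homogeneousPart V N).map (polyEquiv V).toAlgHom.toLinearMap =
      MvPolynomial.homogeneousSubmodule (Fin (finrank ℂ V)) ℂ N := by
  rw [homogeneousPart, Submodule.map_pow, ← MvPolynomial.homogeneousSubmodule_one_pow,
    MvPolynomial.homogeneousSubmodule_one_eq_span_X, LinearMap.range_eq_map,
    ← (coordBasis V).span_eq, Submodule.map_span, Submodule.map_span, ← Set.range_comp,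
    ← Set.range_comp]
  congr 2
  refine congrArg Set.range (funext fun k => ?_)
  exact polyEquiv_coord k

theorem mem_homogeneousPart_iff {N : ℕ} {s : PolyAlg V} :
    s ∈ homogeneousPart V N ↔ (polyEquiv V s).IsHomogeneous N := by
  rw [← MvPolynomial.mem_homogeneousSubmodule, ← map_homogeneousPart]
  refine ⟨fun h => ⟨s, h, rfl⟩, ?_⟩
  rintro ⟨t, ht, h⟩
  exact (polyEquiv V).injective h ▸ ht

/-- The partial derivatives. -/
def partialDeriv (k : Fin (finrank ℂ V)) : PolyAlg V →ₗ[ℂ] PolyAlg V :=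
  (polyEquiv V).symm.toLinearMap ∘ₗ (MvPolynomial.pderiv k).toLinearMap ∘ₗ
    (polyEquiv V).toLinearMap

theorem polyEquiv_partialDeriv (k : Fin (finrank ℂ V)) (s : PolyAlg V) :
    polyEquiv V (partialDeriv k s) = MvPolynomial.pderiv k (polyEquiv V s) :=
  (polyEquiv V).apply_symm_apply _

theorem partialDeriv_mul (k : Fin (finrank ℂ V)) (s t : PolyAlg V) :
    partialDeriv k (s * t) = partialDeriv k s * t + s * partialDeriv k t := by
  apply (polyEquiv V).injective
  simp only [map_mul, map_add, polyEquiv_partialDeriv, MvPolynomial.pderiv_mul]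

theorem partialDeriv_algebraMap (k : Fin (finrank ℂ V)) (c : ℂ) :
    partialDeriv k (algebraMap ℂ (PolyAlg V) c) = 0 := by
  apply (polyEquiv V).injective
  rw [polyEquiv_partialDeriv, AlgEquiv.commutes, MvPolynomial.algebraMap_eq, MvPolynomial.pderiv_C,
    map_zero]

theorem partialDeriv_mem {N : ℕ} {s : PolyAlg V} (hs : s ∈ homogeneousPart V N)
    (k : Fin (finrank ℂ V)) : partialDeriv k s ∈ homogeneousPart V (N - 1) := by
  rw [mem_homogeneousPart_iff] at hs ⊢
  rw [polyEquiv_partialDeriv]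
  exact hs.pderiv

theorem sum_coord_mul_partialDeriv {N : ℕ} {s : PolyAlg V} (hs : s ∈ homogeneousPart V N) :
    ∑ k, coord V k * partialDeriv k s = N • s := by
  apply (polyEquiv V).injective
  rw [mem_homogeneousPart_iff] at hs
  simp only [map_sum, map_mul, polyEquiv_coord, polyEquiv_partialDeriv, map_nsmul,
    hs.sum_X_mul_pderiv]

theorem partialDeriv_aeval {κ : Type*} [Fintype κ] (f : κ → PolyAlg V) (F : MvPolynomial κ ℂ)
    (k : Fin (finrank ℂ V)) :
    partialDeriv k (MvPolynomial.aeval f F) =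
      ∑ i, MvPolynomial.aeval f (MvPolynomial.pderiv i F) * partialDeriv k (f i) := by
  classical
  induction F using MvPolynomial.induction_on with
  | C c => simp [partialDeriv_algebraMap]
  | add p q hp hq => simp only [map_add, hp, hq, add_mul, Finset.sum_add_distrib]
  | mul_X p j hp =>
    simp only [map_mul, MvPolynomial.aeval_X, partialDeriv_mul, hp, MvPolynomial.pderiv_mul,
      MvPolynomial.pderiv_X, map_add, add_mul, Finset.sum_add_distrib, Finset.sum_mul]
    congr 1
    · exact Finset.sum_congr rfl fun i _ => by ring
    · rw [Finset.sum_eq_single j]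
      · simp
      · intro i _ hij
        simp [Pi.single_eq_of_ne' hij]
      · simp

end Coordinates

theorem aeval_monomial_mem {κ : Type*} {f : κ → PolyAlg V} {d : κ → ℕ}
    (hf : ∀ i, f i ∈ homogeneousPart V (d i)) (m : κ →₀ ℕ) (c : ℂ) :
    MvPolynomial.aeval f (MvPolynomial.monomial m c) ∈
      homogeneousPart V (Finsupp.weight d m) := by
  rw [MvPolynomial.aeval_monomial, ← Algebra.smul_def, Finsupp.weight_apply]
  exact Submodule.smul_mem _ _
    (SetLike.prod_pow_mem_graded (homogeneousPart V) d f m fun i _ => hf i)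

theorem comp_aeval {κ : Type*} {f : κ → PolyAlg V} {d : κ → ℕ}
    (hf : ∀ i, f i ∈ homogeneousPart V (d i)) (F : MvPolynomial κ ℂ) (N : ℕ) :
    comp N (MvPolynomial.aeval f F) =
      MvPolynomial.aeval f (MvPolynomial.weightedHomogeneousComponent d N F) := by
  induction F using MvPolynomial.induction_on' with
  | monomial m c =>
    rw [MvPolynomial.weightedHomogeneousComponent_of_mem
      (MvPolynomial.isWeightedHomogeneous_monomial d m c rfl)]
    have h := aeval_monomial_mem hf m c
    split_ifs with hN
    · rw [hN, comp_of_mem h]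
    · rw [comp_of_mem_of_ne h (Ne.symm hN), map_zero]
  | add p q hp hq => simp only [map_add, hp, hq]

theorem eq_C_of_pderiv_eq_zero {κ : Type*} {F : MvPolynomial κ ℂ}
    (h : ∀ i, MvPolynomial.pderiv i F = 0) : F = MvPolynomial.C (MvPolynomial.coeff 0 F) := by
  classical
  ext m
  rw [MvPolynomial.coeff_C]
  split_ifs with hm
  · rw [hm]
  · obtain ⟨i, hi⟩ : ∃ i, m i ≠ 0 := by
      by_contra! h0
      exact hm (Finsupp.ext fun i => (h0 i).symm)
    have h1 := MvPolynomial.coeff_pderiv (i := i) F (m - Finsupp.single i 1)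
    rw [h i, MvPolynomial.coeff_zero, tsub_add_cancel_of_le
      (Finsupp.single_le_iff.2 (Nat.one_le_iff_ne_zero.2 hi))] at h1
    refine (mul_eq_zero.1 h1.symm).resolve_right ?_
    exact Nat.cast_add_one_ne_zero _

theorem sum_subtype_eq_of_eq_zero {κ M : Type*} [Fintype κ] [AddCommMonoid M] (p : κ → Prop)
    [DecidablePred p] {g : κ → M} (h : ∀ i, ¬p i → g i = 0) :
    ∑ i : {i // p i}, g i = ∑ i, g i := by
  rw [← Finset.sum_subtype (Finset.univ.filter p) (by simp) g, Finset.sum_filter]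
  exact Finset.sum_congr rfl fun i _ => by split_ifs with hi <;> simp [h, hi]

/-! ### Generators of the algebra of invariants -/

variable (V) in
/-- The ideal of polynomials that vanish at the origin. -/
def irrelevant : Ideal (PolyAlg V) := Ideal.span (Set.range (SymmetricAlgebra.ι ℂ (Dual ℂ V)))

/-- Homogeneous invariants that are linearly independent modulo `𝔪 I`, where `I` is the Hilbert
ideal, are algebraically independent. -/
theorem IsComplexReflectionGroup.algebraicIndependent [FiniteDimensional ℂ V]
    (hG : IsComplexReflectionGroup G) {κ : Type*} [Fintype κ] {f : κ → PolyAlg V} {d : κ → ℕ}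
    (hf : ∀ i, f i ∈ homogeneousPart V (d i)) (hfG : ∀ i, f i ∈ invariantAlg G)
    (hd : ∀ i, 0 < d i)
    (hind : ∀ c : κ → ℂ, ∑ i, c i • f i ∈ irrelevant V * hilbertIdeal G → c = 0) :
    AlgebraicIndependent ℂ f := by
  classical
  have hR : ∀ F : MvPolynomial κ ℂ, MvPolynomial.aeval f F ∈ invariantAlg G := fun F => by
    have h1 : MvPolynomial.aeval f F ∈ Algebra.adjoin ℂ (Set.range f) := by
      rw [Algebra.adjoin_range_eq_range_aeval]; exact ⟨F, rfl⟩
    refine (Algebra.adjoin_le_iff.2 ?_ : Algebra.adjoin ℂ (Set.range f) ≤ invariantAlg G) h1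
    rintro _ ⟨i, rfl⟩
    exact hfG i
  have key : ∀ (N : ℕ) (F : MvPolynomial κ ℂ), MvPolynomial.IsWeightedHomogeneous d F N →
      MvPolynomial.aeval f F = 0 → F = 0 := by
    intro N
    induction N using Nat.strong_induction_on with
    | _ N ih =>
    intro F hF h0
    -- A variable of weight above `N` cannot occur in `F`. Discarding these indices keeps the
    -- truncated difference `N - d i` an honest degree.
    have hbig : ∀ i, N < d i → MvPolynomial.pderiv i F = 0 := fun i hi => by
      apply MvPolynomial.pderiv_eq_zero_of_notMem_vars
      intro hv
      obtain ⟨m, hm, him⟩ := (MvPolynomial.mem_vars_iff_mem_support i).1 hv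
      have h1 := hF (MvPolynomial.mem_support_iff.1 hm)
      have h2 : m i * d i ≤ Finsupp.weight d m := by
        rw [Finsupp.weight_apply, Finsupp.sum]
        exact Finset.single_le_sum (f := fun j => m j • d j) (fun _ _ => Nat.zero_le _) him
      have h3 := Nat.pos_of_ne_zero (Finsupp.mem_support_iff.1 him)
      have h4 := Nat.le_mul_of_pos_left (d i) h3
      omega
    have hsmall : ∀ i, d i ≤ N →
        MvPolynomial.IsWeightedHomogeneous d (MvPolynomial.pderiv i F) (N - d i) := fun i hi =>
      hF.pderiv (Nat.sub_add_cancel hi)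
    by_cases hall : ∀ i : {i // d i ≤ N}, MvPolynomial.aeval f (MvPolynomial.pderiv i.1 F) = 0
    · have hp : ∀ i, MvPolynomial.pderiv i F = 0 := fun i => by
        by_cases hi : d i ≤ N
        · exact ih (N - d i) (by have := hd i; omega) _ (hsmall i hi) (hall ⟨i, hi⟩)
        · exact hbig i (not_le.1 hi)
      have hC := eq_C_of_pderiv_eq_zero hp
      rw [hC, MvPolynomial.aeval_C] at h0
      rw [hC, (map_eq_zero_iff _ (algebraMap ℂ (PolyAlg V)).injective).1 h0, map_zero]
    · exfalso
      push Not at hall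
      have hrel : ∀ k, ∑ i : {i // d i ≤ N},
          MvPolynomial.aeval f (MvPolynomial.pderiv i.1 F) * partialDeriv k (f i) = 0 := by
        intro k
        have h1 := partialDeriv_aeval f F k
        rw [h0, map_zero] at h1
        rw [h1]
        exact sum_subtype_eq_of_eq_zero (fun i => d i ≤ N)
          (g := fun i => MvPolynomial.aeval f (MvPolynomial.pderiv i F) * partialDeriv k (f i))
          fun i hi => by
          rw [hbig i (not_le.1 hi), map_zero, zero_mul]
      obtain ⟨c, ⟨j, hj⟩, hc⟩ := hG.exists_relation
        (a := fun i : {i // d i ≤ N} => MvPolynomial.aeval f (MvPolynomial.pderiv i.1 F))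
        (fun i => hR _) (δ := fun i => N - d i)
        (fun i => by
          have := hsmall i.1 i.2
          have h2 := comp_aeval hf (MvPolynomial.pderiv i.1 F) (N - d i)
          rw [MvPolynomial.weightedHomogeneousComponent_eq_self this] at h2
          rw [← h2]
          exact comp_mem _ _)
        hall (u := fun k i => partialDeriv k (f i)) (ν := fun _ i => d i - 1)
        (fun k i => partialDeriv_mem (hf i) k) (D := fun _ => N - 1)
        (fun k i => by have := i.2; have := hd i; omega) hrel
      -- Multiplying the `k`-th relation by the `k`-th coordinate and summing gives, by Euler's
      -- identity, the factor `d i` and membership in `𝔪 I`.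
      let c' : κ → ℂ := fun i => if h : d i ≤ N then c ⟨i, h⟩ * d i else 0
      have hc' : c' = 0 := by
        apply hind
        have e : ∑ i, c' i • f i =
            ∑ k, coord V k * ∑ i : {i // d i ≤ N}, c i • partialDeriv k (f i) := by
          simp only [Finset.mul_sum, mul_smul_comm]
          rw [Finset.sum_comm]
          simp only [← Finset.smul_sum, sum_coord_mul_partialDeriv (hf _)]
          rw [← sum_subtype_eq_of_eq_zero (fun i => d i ≤ N) fun i hi => by
            simp only [c', dif_neg hi, zero_smul]]
          refine Finset.sum_congr rfl fun i _ => ?_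
          simp only [c', dif_pos i.2]
          rw [mul_smul, Nat.cast_smul_eq_nsmul]
        rw [e]
        exact Submodule.sum_mem _ fun k _ =>
          Ideal.mul_mem_mul (Ideal.subset_span ⟨_, rfl⟩) (hc k)
      have := congrFun hc' j
      simp only [c', dif_pos j.2, Pi.zero_apply, mul_eq_zero, hj, false_or, Nat.cast_eq_zero] at this
      exact (hd j).ne' this
  rw [algebraicIndependent_iff]
  intro F hF
  rw [← MvPolynomial.sum_weightedHomogeneousComponent d F]
  refine finsum_eq_zero_of_forall_eq_zero fun N => ?_
  refine key N _ (MvPolynomial.weightedHomogeneousComponent_isWeightedHomogeneous N F) ?_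
  rw [← comp_aeval hf, hF, map_zero]

/-- Homogeneous invariants of positive degree that generate the Hilbert ideal generate the algebra
of invariants. -/
theorem adjoin_eq_of_span_eq [Fintype G] {κ : Type*} {f : κ → PolyAlg V} {d : κ → ℕ}
    (hf : ∀ i, f i ∈ homogeneousPart V (d i)) (hfG : ∀ i, f i ∈ invariantAlg G)
    (hd : ∀ i, 0 < d i) (hspan : hilbertIdeal G ≤ Ideal.span (Set.range f)) :
    Algebra.adjoin ℂ (Set.range f) = invariantAlg G := by
  apply le_antisymm
  · rw [Algebra.adjoin_le_iff]
    rintro _ ⟨i, rfl⟩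
    exact hfG i
  have key : ∀ N, ∀ r ∈ invariantAlg G, r ∈ homogeneousPart V N →
      r ∈ Algebra.adjoin ℂ (Set.range f) := by
    intro N
    induction N using Nat.strong_induction_on with
    | _ N ih =>
    intro r hr hrN
    obtain rfl | hN := Nat.eq_zero_or_pos N
    · obtain ⟨c, rfl⟩ := mem_homogeneousPart_zero.1 hrN
      exact Subalgebra.algebraMap_mem _ c
    have h1 := comp_mem_span_of_mem_ideal_span hf
      (hspan (Ideal.subset_span ⟨hr, N, hN, hrN⟩)) N
    rw [comp_of_mem hrN] at h1
    -- Averaging an expression `r = ∑ s_t f_t` replaces each coefficient by an invariant of degree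
    -- `N - d t < N`, covered by induction.
    have h2 : Submodule.span ℂ {y | ∃ t, d t ≤ N ∧ ∃ s ∈ homogeneousPart V (N - d t), s * f t = y} ≤
        (Subalgebra.toSubmodule (Algebra.adjoin ℂ (Set.range f))).comap (reynolds G) := by
      refine Submodule.span_le.2 ?_
      rintro _ ⟨t, ht, s, hs, rfl⟩
      change reynolds G (s * f t) ∈ Algebra.adjoin ℂ (Set.range f)
      rw [mul_comm, reynolds_mul (hfG t)]
      exact mul_mem (Algebra.subset_adjoin ⟨t, rfl⟩)
        (ih (N - d t) (by have := hd t; omega) _ (reynolds_mem s) (reynolds_mem_homogeneousPart hs))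
    have h3 := h2 h1
    rw [Submodule.mem_comap, reynolds_of_mem hr] at h3
    exact h3
  intro r hr
  exact mem_of_comp_mem fun N => key N _ (comp_mem_invariantAlg hr N) (comp_mem N r)

/-- Homogeneous invariants that span the Hilbert ideal `I` modulo `𝔪 I` generate it. -/
theorem hilbertIdeal_le_span {κ : Type*} {f : κ → PolyAlg V}
    (hspan : ∀ r ∈ positiveInvariants G, ∃ t ∈ Submodule.span ℂ (Set.range f),
      r - t ∈ irrelevant V * hilbertIdeal G) {d : κ → ℕ}
    (hf : ∀ i, f i ∈ homogeneousPart V (d i)) :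
    hilbertIdeal G ≤ Ideal.span (Set.range f) := by
  have hle : Submodule.span ℂ (Set.range f) ≤ (Ideal.span (Set.range f)).restrictScalars ℂ :=
    Submodule.span_le.2 Ideal.subset_span
  let b : Dual ℂ V × positiveInvariants G → PolyAlg V := fun p =>
    SymmetricAlgebra.ι ℂ (Dual ℂ V) p.1 * (p.2 : PolyAlg V)
  have hb : ∀ p, b p ∈ homogeneousPart V (1 + positiveInvariants.degree G p.2) := fun p =>
    mul_mem_homogeneousPart (ι_mem_homogeneousPart _) (positiveInvariants.mem _)
  have hbI : irrelevant V * hilbertIdeal G ≤ Ideal.span (Set.range b) := by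
    rw [irrelevant, hilbertIdeal, Ideal.span_mul_span']
    refine Ideal.span_mono ?_
    rintro _ ⟨_, ⟨l, rfl⟩, r, hr, rfl⟩
    exact ⟨(l, ⟨r, hr⟩), rfl⟩
  -- Graded Nakayama: in degree `N` the error term from `𝔪 I` involves only invariants of degree
  -- below `N`.
  have key : ∀ N, ∀ r : positiveInvariants G, positiveInvariants.degree G r = N →
      (r : PolyAlg V) ∈ Ideal.span (Set.range f) := by
    intro N
    induction N using Nat.strong_induction_on with
    | _ N ih =>
    intro r hr
    obtain ⟨t, ht, hrt⟩ := hspan r r.2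
    have h1 := comp_mem_span_of_mem_ideal_span hb (hbI hrt) N
    have h2 : Submodule.span ℂ {y | ∃ t, 1 + positiveInvariants.degree G t.2 ≤ N ∧
        ∃ s ∈ homogeneousPart V (N - (1 + positiveInvariants.degree G t.2)), s * b t = y} ≤
        (Ideal.span (Set.range f)).restrictScalars ℂ := by
      refine Submodule.span_le.2 ?_
      rintro _ ⟨p, hp, s, _, rfl⟩
      exact Ideal.mul_mem_left _ _ (Ideal.mul_mem_left _ _ (ih _ (by omega) p.2 rfl))
    have h3 := comp_mem_ideal_span hf (hle ht) N
    have h4 := add_mem (h2 h1) h3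
    rw [← map_add, sub_add_cancel, comp_of_mem (hr ▸ positiveInvariants.mem r)] at h4
    exact h4
  exact Ideal.span_le.2 fun r hr => key _ ⟨r, hr⟩ rfl

/-! ### Counting the generators -/

variable (G) in
/-- The action of `G` on `ℂ[V]` by ring automorphisms. -/
abbrev polyMulSemiringAction : MulSemiringAction G (PolyAlg V) where
  smul g s := polyAct (g : V ≃ₗ[ℂ] V) s
  one_smul s := polyAct_one_apply s
  mul_smul g h s := polyAct_mul_apply (g : V ≃ₗ[ℂ] V) (h : V ≃ₗ[ℂ] V) s
  smul_zero g := map_zero (polyAct (g : V ≃ₗ[ℂ] V))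
  smul_add g := map_add (polyAct (g : V ≃ₗ[ℂ] V))
  smul_one g := map_one (polyAct (g : V ≃ₗ[ℂ] V))
  smul_mul g := map_mul (polyAct (g : V ≃ₗ[ℂ] V))

theorem isIntegral_invariantAlg [Finite G] : Algebra.IsIntegral (invariantAlg G) (PolyAlg V) := by
  let := polyMulSemiringAction G
  have : Algebra.IsInvariant (invariantAlg G) (PolyAlg V) G :=
    ⟨fun b hb => ⟨⟨b, fun g hg => hb ⟨g, hg⟩⟩, rfl⟩⟩
  exact Algebra.IsInvariant.isIntegral (invariantAlg G) (PolyAlg V) G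

/-- As `ℂ[V]` is integral over the invariants, `f` is a transcendence basis of `ℂ[V]`, as are the
coordinates. -/
theorem nonempty_equiv_fin_finrank [FiniteDimensional ℂ V] [Finite G] {κ : Type*} {f : κ → PolyAlg V}
    (hind : AlgebraicIndependent ℂ f) (hf : Algebra.adjoin ℂ (Set.range f) = invariantAlg G) :
    Nonempty (κ ≃ Fin (finrank ℂ V)) := by
  have hint : Algebra.IsIntegral (Algebra.adjoin ℂ (Set.range f)) (PolyAlg V) := by
    rw [hf]; exact isIntegral_invariantAlg
  have h1 : IsTranscendenceBasis ℂ f :=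
    hind.isTranscendenceBasis_iff_isAlgebraic.2 inferInstance
  have h2 := (polyEquiv V).symm.isTranscendenceBasis
    (IsTranscendenceBasis.mvPolynomial (Fin (finrank ℂ V)) ℂ)
  exact Cardinal.lift_mk_eq'.1 (h1.lift_cardinalMk_eq h2)

theorem IsComplexReflectionGroup.exists_isBasicInvariants [FiniteDimensional ℂ V]
    (hG : IsComplexReflectionGroup G) :
    ∃ (f : Fin (finrank ℂ V) → PolyAlg V) (d : Fin (finrank ℂ V) → ℕ), IsBasicInvariants G f d := by
  classical
  have := hG.finite
  have := Fintype.ofFinite G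
  let Q := PolyAlg V ⧸ (irrelevant V * hilbertIdeal G)
  let π : PolyAlg V →ₗ[ℂ] Q := (Ideal.Quotient.mkₐ ℂ (irrelevant V * hilbertIdeal G)).toLinearMap
  have hπ : ∀ s, π s = 0 ↔ s ∈ irrelevant V * hilbertIdeal G := fun s =>
    Ideal.Quotient.eq_zero_iff_mem
  obtain ⟨κ, a, -, hspan, hli⟩ := exists_linearIndependent' ℂ
    (fun r : positiveInvariants G => π (r : PolyAlg V))
  let f : κ → PolyAlg V := fun i => (a i : PolyAlg V)
  let d : κ → ℕ := fun i => positiveInvariants.degree G (a i)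
  have hf : ∀ i, f i ∈ homogeneousPart V (d i) := fun i => positiveInvariants.mem _
  have hd : ∀ i, 0 < d i := fun i => positiveInvariants.degree_pos _
  have hfG : ∀ i, f i ∈ invariantAlg G := fun i => (a i).2.1
  have hI : hilbertIdeal G ≤ Ideal.span (Set.range f) := by
    refine hilbertIdeal_le_span (fun r hr => ?_) hf
    have h1 : π r ∈ Submodule.span ℂ (Set.range ((fun r : positiveInvariants G =>
        π (r : PolyAlg V)) ∘ a)) := by
      rw [hspan]; exact Submodule.subset_span ⟨⟨r, hr⟩, rfl⟩
    rw [show ((fun r : positiveInvariants G => π (r : PolyAlg V)) ∘ a) = π ∘ f from rfl,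
      Set.range_comp, ← Submodule.map_span] at h1
    obtain ⟨t, ht, htr⟩ := h1
    exact ⟨t, ht, (hπ _).1 (by rw [map_sub, htr, sub_self])⟩
  have hgen := adjoin_eq_of_span_eq hf hfG hd hI
  have hai : AlgebraicIndependent ℂ f := by
    -- The family `κ` is not yet known to be finite; its finiteness comes out of the transcendence
    -- degree below.
    refine algebraicIndependent_of_finite_type fun t ht => ?_
    have := ht.fintype
    refine hG.algebraicIndependent (fun i => hf i) (fun i => hfG i) (fun i => hd i) fun c hc => ?_
    have h1 := hli.comp ((↑) : t → κ) Subtype.val_injective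
    rw [Fintype.linearIndependent_iff] at h1
    refine funext fun i => h1 c ?_ i
    rw [← (hπ _).2 hc, map_sum]
    exact Finset.sum_congr rfl fun i _ => (map_smul π _ _).symm
  obtain ⟨e⟩ := nonempty_equiv_fin_finrank hai hgen
  refine ⟨f ∘ e.symm, d ∘ e.symm, fun i => hf _, hai.comp _ e.symm.injective, ?_⟩
  rw [Set.range_comp, e.symm.surjective.range_eq, Set.image_univ, hgen]

/-- Basic invariants have positive degrees. -/
theorem IsBasicInvariants.degree_pos {n : ℕ} {f : Fin n → PolyAlg V} {d : Fin n → ℕ}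
    (h : IsBasicInvariants G f d) (i : Fin n) : 0 < d i := by
  by_contra hi
  have h0 := h.homogeneous i
  rw [Nat.eq_zero_of_not_pos hi] at h0
  obtain ⟨c, hc⟩ := mem_homogeneousPart_zero.1 h0
  have h1 := h.algebraicIndependent.transcendental i
  rw [← hc] at h1
  exact h1 (isAlgebraic_algebraMap c)

theorem IsBasicInvariants.mem_invariantAlg {n : ℕ} {f : Fin n → PolyAlg V} {d : Fin n → ℕ}
    (h : IsBasicInvariants G f d) (i : Fin n) : f i ∈ invariantAlg G :=
  h.adjoin_eq ▸ Algebra.subset_adjoin ⟨i, rfl⟩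

theorem IsBasicInvariants.span_eq {n : ℕ} {f : Fin n → PolyAlg V} {d : Fin n → ℕ}
    (h : IsBasicInvariants G f d) : Ideal.span (Set.range f) = hilbertIdeal G := by
  apply le_antisymm
  · refine Ideal.span_le.2 ?_
    rintro _ ⟨i, rfl⟩
    exact Ideal.subset_span ⟨h.mem_invariantAlg i, d i, h.degree_pos i, h.homogeneous i⟩
  · refine Ideal.span_le.2 ?_
    rintro r ⟨hr, N, hN, hrN⟩
    rw [← h.adjoin_eq] at hr
    -- A polynomial in the `f i` is congruent to its constant term modulo `(f)`; taking the
    -- component of degree `N > 0` then removes the constant.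
    have key : ∃ c : ℂ, r - algebraMap ℂ _ c ∈ Ideal.span (Set.range f) := by
      clear hrN
      induction hr using Algebra.adjoin_induction with
      | mem x hx => exact ⟨0, by rw [map_zero, sub_zero]; exact Ideal.subset_span hx⟩
      | algebraMap c => exact ⟨c, by rw [sub_self]; exact zero_mem _⟩
      | add x y _ _ hx hy =>
        obtain ⟨a, ha⟩ := hx
        obtain ⟨b, hb⟩ := hy
        refine ⟨a + b, ?_⟩
        rw [map_add, add_sub_add_comm]
        exact add_mem ha hb
      | mul x y _ _ hx hy =>
        obtain ⟨a, ha⟩ := hx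
        obtain ⟨b, hb⟩ := hy
        refine ⟨a * b, ?_⟩
        have e : x * y - algebraMap ℂ (PolyAlg V) (a * b) =
            y * (x - algebraMap ℂ _ a) + algebraMap ℂ _ a * (y - algebraMap ℂ _ b) := by
          rw [map_mul]; ring
        rw [e]
        exact add_mem (Ideal.mul_mem_left _ _ ha) (Ideal.mul_mem_left _ _ hb)
    obtain ⟨c, hc⟩ := key
    have h1 := comp_mem_ideal_span h.homogeneous hc N
    rwa [map_sub, comp_of_mem hrN,
      comp_of_mem_of_ne (mem_homogeneousPart_zero.2 ⟨c, rfl⟩) hN.ne, sub_zero] at h1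

end

section

variable {V : Type u} [AddCommGroup V] [Module ℂ V] {G : Subgroup (V ≃ₗ[ℂ] V)}

/-! ### A graded complement of the Hilbert ideal -/

theorem comp_mem_of_mem_hilbertIdeal {x : PolyAlg V} (hx : x ∈ hilbertIdeal G) (N : ℕ) :
    comp N x ∈ hilbertIdeal G := by
  have h := comp_mem_ideal_span (b := fun r : positiveInvariants G => (r : PolyAlg V))
    positiveInvariants.mem (by rwa [Subtype.range_coe]) N
  rwa [Subtype.range_coe] at h

theorem exists_homogeneous_complement [Finite G] (N : ℕ) :
    ∃ C : Submodule ℂ (PolyAlg V), (∀ g ∈ G, ∀ x ∈ C, polyAct g x ∈ C) ∧ C ≤ homogeneousPart V N ∧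
      Disjoint C ((hilbertIdeal G).restrictScalars ℂ) ∧
      homogeneousPart V N ≤ C ⊔ (hilbertIdeal G).restrictScalars ℂ := by
  -- Maschke's theorem is applied inside all of `ℂ[V]`; the complement is cut down to degree `N`
  -- afterwards, by the modular law.
  let P : Subrepresentation (polyRep G) :=
    ⟨(hilbertIdeal G).restrictScalars ℂ ⊓ homogeneousPart V N, fun g x hx =>
      ⟨polyAct_mem_hilbertIdeal g.2 hx.1, polyAct_mem _ hx.2⟩⟩
  have : NeZero (Nat.card G : ℂ) := ⟨Nat.cast_ne_zero.2 Nat.card_pos.ne'⟩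
  obtain ⟨D, hD⟩ := exists_isCompl P
  have hinf : D.toSubmodule ⊓ ((hilbertIdeal G).restrictScalars ℂ ⊓ homogeneousPart V N) = ⊥ := by
    have := hD.symm.inf_eq_bot
    rw [← Subrepresentation.toSubmodule_injective.eq_iff] at this
    exact this
  have hsup : ((hilbertIdeal G).restrictScalars ℂ ⊓ homogeneousPart V N) ⊔ D.toSubmodule = ⊤ := by
    have := hD.sup_eq_top
    rw [← Subrepresentation.toSubmodule_injective.eq_iff] at this
    exact this
  refine ⟨D.toSubmodule ⊓ homogeneousPart V N, fun g hg x hx =>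
    ⟨D.apply_mem_toSubmodule ⟨g, hg⟩ hx.1, polyAct_mem _ hx.2⟩, inf_le_right, ?_, fun x hx => ?_⟩
  · rw [disjoint_iff, inf_assoc, inf_comm (homogeneousPart V N)]
    exact hinf
  · have hx' : x ∈ ((hilbertIdeal G).restrictScalars ℂ ⊓ homogeneousPart V N) ⊔ D.toSubmodule := by
      rw [hsup]; trivial
    obtain ⟨y, hy, z, hz, rfl⟩ := Submodule.mem_sup.1 hx'
    rw [add_comm]
    refine Submodule.add_mem_sup ⟨hz, ?_⟩ hy.1
    have := sub_mem hx hy.2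
    rwa [add_sub_cancel_left] at this

variable (G) in
/-- A graded `G`-stable complement of the Hilbert ideal. -/
structure IsGradedComplement (E : Submodule ℂ (PolyAlg V)) : Prop where
  stable : ∀ g ∈ G, ∀ x ∈ E, polyAct g x ∈ E
  graded : ∀ N, ∀ x ∈ E, comp N x ∈ E
  isCompl : IsCompl E ((hilbertIdeal G).restrictScalars ℂ)

variable (G) in
theorem exists_isGradedComplement [Finite G] :
    ∃ E : Submodule ℂ (PolyAlg V), IsGradedComplement G E := by
  choose C hC hCN hdisj hsup using exists_homogeneous_complement (G := G)
  have hcomp : ∀ N, ∀ x ∈ ⨆ N, C N, comp N x ∈ C N := fun N x hx => by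
    refine Submodule.iSup_induction C (motive := fun x => comp N x ∈ C N) hx (fun M y hy => ?_) ?_
      fun y z hy hz => ?_
    · by_cases h : M = N
      · subst h
        rwa [comp_of_mem (hCN M hy)]
      · rw [comp_of_mem_of_ne (hCN M hy) h]
        exact zero_mem _
    · rw [map_zero]; exact zero_mem _
    · rw [map_add]; exact add_mem hy hz
  refine ⟨⨆ N, C N, fun g hg x hx => ?_, fun N x hx => le_iSup C N (hcomp N x hx), ?_, ?_⟩
  · refine Submodule.iSup_induction C (motive := fun x => polyAct g x ∈ ⨆ N, C N) hx
      (fun N y hy => le_iSup C N (hC N g hg y hy)) ?_ fun y z hy hz => ?_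
    · rw [map_zero]; exact zero_mem _
    · rw [map_add]; exact add_mem hy hz
  · rw [Submodule.disjoint_def]
    exact fun x hx hxI => eq_zero_of_comp fun N => Submodule.disjoint_def.1 (hdisj N) _
      (hcomp N x hx) (comp_mem_of_mem_hilbertIdeal hxI N)
  · rw [codisjoint_iff, eq_top_iff, ← iSup_homogeneousPart]
    exact iSup_le fun N => (hsup N).trans (sup_le_sup_right (le_iSup C N) _)

variable {E : Submodule ℂ (PolyAlg V)}

theorem IsGradedComplement.exists_homogeneous_basis (hE : IsGradedComplement G E) :
    ∃ (κ : Type u) (e : Basis κ ℂ E) (ε : κ → ℕ),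
      ∀ j, (e j : PolyAlg V) ∈ homogeneousPart V (ε j) := by
  let T := {s : E // ∃ N, (s : PolyAlg V) ∈ homogeneousPart V N}
  obtain ⟨κ, a, -, hspan, hli⟩ := exists_linearIndependent' ℂ (fun s : T => s.1)
  refine ⟨κ, Basis.mk hli ?_, fun j => (a j).2.choose, fun j => ?_⟩
  · rw [hspan]
    rintro ⟨x, hx⟩ -
    classical
    have h1 : (⟨x, hx⟩ : E) = ∑ N ∈ (DirectSum.decompose (homogeneousPart V) x).support,
        ⟨comp N x, hE.graded N x hx⟩ := by
      apply Subtype.ext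
      rw [AddSubmonoidClass.coe_finsetSum]
      exact (DirectSum.sum_support_decompose (homogeneousPart V) x).symm
    rw [h1]
    exact Submodule.sum_mem _ fun N _ =>
      Submodule.subset_span ⟨⟨⟨comp N x, hE.graded N x hx⟩, N, comp_mem N x⟩, rfl⟩
  · rw [Basis.mk_apply]
    exact (a j).2.choose_spec

/-- A graded complement of the Hilbert ideal generates `ℂ[V]` as a module over the invariants. -/
theorem IsGradedComplement.span_eq_top (hE : IsGradedComplement G E) :
    Submodule.span (invariantAlg G) (E : Set (PolyAlg V)) = ⊤ := by
  have key : ∀ N, ∀ s ∈ homogeneousPart V N,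
      s ∈ Submodule.span (invariantAlg G) (E : Set (PolyAlg V)) := by
    intro N
    induction N using Nat.strong_induction_on with
    | _ N ih =>
    intro s hs
    have h1 : s ∈ E ⊔ (hilbertIdeal G).restrictScalars ℂ := by
      rw [hE.isCompl.sup_eq_top]; trivial
    obtain ⟨x, hx, y, hy, hxy⟩ := Submodule.mem_sup.1 h1
    rw [← comp_of_mem hs, ← hxy, map_add]
    refine add_mem (Submodule.subset_span (hE.graded N x hx)) ?_
    have h2 : Submodule.span ℂ {y | ∃ r : positiveInvariants G,
        positiveInvariants.degree G r ≤ N ∧ ∃ s ∈ homogeneousPart V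
          (N - positiveInvariants.degree G r), s * (r : PolyAlg V) = y} ≤
        (Submodule.span (invariantAlg G) (E : Set (PolyAlg V))).restrictScalars ℂ := by
      refine Submodule.span_le.2 ?_
      rintro _ ⟨r, hr, t, ht, rfl⟩
      rw [mul_comm]
      have := positiveInvariants.degree_pos r
      exact Submodule.smul_mem _ (⟨r, r.2.1⟩ : invariantAlg G) (ih _ (by omega) t ht)
    exact h2 (comp_mem_hilbertIdeal hy N)
  rw [eq_top_iff]
  rintro s -
  exact mem_of_comp_mem fun N => key N _ (comp_mem N s)

theorem IsGradedComplement.span_range_basis (hE : IsGradedComplement G E) {κ : Type*}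
    (b : Basis κ ℂ E) :
    Submodule.span (invariantAlg G) (Set.range fun j => (b j : PolyAlg V)) = ⊤ := by
  rw [eq_top_iff, ← hE.span_eq_top, Submodule.span_le]
  intro x hx
  have h1 : Submodule.span ℂ (Set.range fun j => (b j : PolyAlg V)) ≤
      (Submodule.span (invariantAlg G)
        (Set.range fun j => (b j : PolyAlg V))).restrictScalars ℂ :=
    Submodule.span_le.2 Submodule.subset_span
  refine h1 ?_
  have h2 : (⟨x, hx⟩ : E) ∈ Submodule.span ℂ (Set.range b) := by rw [b.span_eq]; trivial
  have h3 := Submodule.mem_map_of_mem (f := E.subtype) h2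
  rwa [Submodule.map_span, ← Set.range_comp] at h3

/-- A homogeneous basis of a graded complement is linearly independent over the invariants. -/
theorem IsGradedComplement.linearIndependent (hE : IsGradedComplement G E)
    (hG : IsComplexReflectionGroup G) {κ : Type*} (e : Basis κ ℂ E) {ε : κ → ℕ}
    (hε : ∀ j, (e j : PolyAlg V) ∈ homogeneousPart V (ε j)) :
    LinearIndependent (invariantAlg G) fun j => (e j : PolyAlg V) := by
  classical
  rw [linearIndependent_iff']
  intro s r hr
  have hr' : ∑ j ∈ s, (r j : PolyAlg V) * (e j : PolyAlg V) = 0 := hr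
  -- The degree `D` part of the relation is homogeneous. If nonzero coefficients survived,
  -- `exists_relation` would give a complex relation among the `e j` inside the Hilbert ideal, which
  -- meets `E` trivially.
  have key : ∀ D, ∀ j ∈ s, ε j ≤ D → comp (D - ε j) (r j : PolyAlg V) = 0 := by
    intro D
    by_contra! hne
    obtain ⟨j₀, hj₀, hD₀, hne⟩ := hne
    let ι := {j : s // ε j ≤ D}
    have hsum : ∑ j : ι, comp (D - ε j.1) (r j.1 : PolyAlg V) * (e j.1 : PolyAlg V) = 0 := by
      have h1 := congrArg (comp D) hr'
      rw [map_sum, map_zero, ← Finset.sum_coe_sort] at h1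
      rw [← h1, ← sum_subtype_eq_of_eq_zero (fun j : s => ε j ≤ D)
        (g := fun j : s => comp D ((r j : PolyAlg V) * (e j : PolyAlg V)))
        fun j hj => by rw [comp_mul_right D (hε j), if_neg hj]]
      exact Finset.sum_congr rfl fun j _ => by rw [comp_mul_right D (hε j.1), if_pos j.2]
    obtain ⟨c, ⟨j, hj⟩, hc⟩ := hG.exists_relation (κ := Unit)
      (a := fun j : ι => comp (D - ε j.1) (r j.1 : PolyAlg V))
      (fun j => comp_mem_invariantAlg (r j.1).2 _) (δ := fun j => D - ε j.1)
      (fun j => comp_mem _ _) ⟨⟨⟨j₀, hj₀⟩, hD₀⟩, hne⟩ (u := fun _ j => (e j.1 : PolyAlg V))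
      (ν := fun _ j => ε j.1) (fun _ j => hε _) (D := fun _ => D)
      (fun _ j => Nat.sub_add_cancel j.2) (fun _ => hsum)
    have hinj : Function.Injective fun j : ι => (j.1 : κ) :=
      Subtype.val_injective.comp Subtype.val_injective
    have h2 := e.linearIndependent.comp _ hinj
    rw [Fintype.linearIndependent_iff] at h2
    refine hj (h2 c ?_ j)
    apply Subtype.ext
    refine Submodule.disjoint_def.1 hE.isCompl.disjoint _ (SetLike.coe_mem _) ?_
    have h3 := hc ()
    rw [AddSubmonoidClass.coe_finsetSum]
    exact h3
  intro j hj
  apply Subtype.ext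
  exact eq_zero_of_comp fun N => by
    have := key (N + ε j) j hj (Nat.le_add_left _ _)
    rwa [Nat.add_sub_cancel] at this

/-! ### The rank of `ℂ[V]` over the invariants -/

theorem ι_injective : Function.Injective (SymmetricAlgebra.ι ℂ (Dual ℂ V)) :=
  (injective_iff_map_eq_zero _).2 fun _ h => by_contra fun hl => ι_ne_zero hl h

theorem eq_of_dual_eq {v w : V} (h : ∀ l : Dual ℂ V, l v = l w) : v = w :=
  sub_eq_zero.1 ((Module.forall_dual_apply_eq_zero_iff ℂ _).1 fun l => by rw [map_sub, h, sub_self])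

theorem polyAct_injective : Function.Injective fun g : V ≃ₗ[ℂ] V => polyAct g := by
  intro g h hgh
  rw [← inv_inj]
  ext v
  refine eq_of_dual_eq fun l => ?_
  have := DFunLike.congr_fun hgh (SymmetricAlgebra.ι ℂ (Dual ℂ V) l)
  simp only [polyAct_ι] at this
  exact LinearMap.congr_fun (ι_injective this) v

/-- The matrix `(g e_j)` defines an injective map over `ℂ[V]`. For `c` in its kernel, multiplying by
`s` and summing over `G` gives an invariant relation among the `e j`, so the trace of `c j * s`
vanishes for every `s`; Dedekind independence of the automorphisms then forces `c j = 0`. -/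
theorem card_le_of_linearIndependent [Fintype G] {κ : Type*} [Fintype κ] {e : κ → PolyAlg V}
    (he : LinearIndependent (invariantAlg G) e) : Fintype.card κ ≤ Fintype.card G := by
  let L : (κ → PolyAlg V) →ₗ[PolyAlg V] (G → PolyAlg V) :=
    LinearMap.pi fun g => ∑ j, LinearMap.smulRight (LinearMap.proj j)
      (polyAct (g : V ≃ₗ[ℂ] V) (e j))
  have hL : ∀ c g, L c g = ∑ j, c j * polyAct (g : V ≃ₗ[ℂ] V) (e j) := fun c g => by
    simp [L]
  refine card_le_of_injective (PolyAlg V) L ((injective_iff_map_eq_zero _).2 fun c hc => ?_)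
  have h1 : ∀ g : G, ∑ j, polyAct (g : V ≃ₗ[ℂ] V) (c j) * e j = 0 := fun g => by
    have h := congrArg (polyAct (g : V ≃ₗ[ℂ] V)) (congrFun hc g⁻¹)
    rw [hL, map_sum, Pi.zero_apply, map_zero] at h
    rw [← h]
    refine Finset.sum_congr rfl fun j _ => ?_
    rw [map_mul, ← polyAct_mul_apply, Subgroup.coe_inv, mul_inv_cancel, polyAct_one_apply]
  funext j
  have h2 : ∀ s : PolyAlg V, ∑ g : G, polyAct (g : V ≃ₗ[ℂ] V) (c j) * polyAct (g : V ≃ₗ[ℂ] V) s = 0 := by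
    intro s
    rw [Fintype.linearIndependent_iff] at he
    have h3 := he (fun j => ⟨_, sum_polyAct_mem (c j * s)⟩) ?_ j
    · have := congrArg Subtype.val h3
      simp only [map_mul] at this
      exact this
    · change ∑ j, (∑ g : G, polyAct (g : V ≃ₗ[ℂ] V) (c j * s)) * e j = 0
      simp only [Finset.sum_mul]
      rw [Finset.sum_comm]
      refine Finset.sum_eq_zero fun g _ => ?_
      rw [← mul_zero (polyAct (g : V ≃ₗ[ℂ] V) s), ← h1 g, Finset.mul_sum]
      refine Finset.sum_congr rfl fun j _ => ?_
      rw [map_mul]; ring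
  have h4 := (linearIndependent_monoidHom (PolyAlg V) (PolyAlg V)).comp
    (fun g : G => ((polyAct (g : V ≃ₗ[ℂ] V) : PolyAlg V →ₐ[ℂ] PolyAlg V) : PolyAlg V →* PolyAlg V))
    (fun g h hgh => Subtype.ext (polyAct_injective (AlgHom.ext fun s => DFunLike.congr_fun hgh s)))
  rw [Fintype.linearIndependent_iff] at h4
  have h5 := h4 (fun g => polyAct (g : V ≃ₗ[ℂ] V) (c j)) (funext fun s => by
    simpa using h2 s) 1
  rwa [Subgroup.coe_one, polyAct_one_apply] at h5

end

section

variable {V : Type u} [AddCommGroup V] [Module ℂ V] {G : Subgroup (V ≃ₗ[ℂ] V)}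

/-! ### The values on a free orbit -/

variable (G) in
-- A complex vector space is not a finite union of proper subspaces, here the fixed spaces of the
-- nontrivial elements.
theorem exists_trivial_stabilizer [Finite G] : ∃ v : V, ∀ g ∈ G, g v = v → g = 1 := by
  by_contra! h
  have hcov : ⋃ g : {g : G // g ≠ 1},
      (LinearMap.ker (((g.1 : V ≃ₗ[ℂ] V) : End ℂ V) - 1) : Set V) = Set.univ := by
    refine Set.eq_univ_of_forall fun v => ?_
    obtain ⟨g, hg, hgv, hg1⟩ := h v
    refine Set.mem_iUnion.2 ⟨⟨⟨g, hg⟩, fun he => hg1 (congrArg Subtype.val he)⟩, ?_⟩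
    exact LinearMap.mem_ker.2 (sub_eq_zero.2 hgv)
  obtain ⟨g, hg⟩ := Subspace.exists_eq_top_of_iUnion_eq_univ hcov
  refine g.2 (Subtype.ext (LinearEquiv.ext fun v => ?_))
  have hv : v ∈ LinearMap.ker (((g.1 : V ≃ₗ[ℂ] V) : End ℂ V) - 1) := by rw [hg]; trivial
  exact sub_eq_zero.1 (LinearMap.mem_ker.1 hv)

variable (G) in
/-- The values of a polynomial on the orbit of `v`. -/
def evalOrbit (v : V) : PolyAlg V →ₗ[ℂ] (G → ℂ) :=
  LinearMap.pi fun g => (evalAt ((g : V ≃ₗ[ℂ] V) v)).toLinearMap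

theorem evalOrbit_apply (v : V) (s : PolyAlg V) (g : G) :
    evalOrbit G v s g = evalAt ((g : V ≃ₗ[ℂ] V) v) s := rfl

theorem evalOrbit_polyAct (v : V) (s : PolyAlg V) (h g : G) :
    evalOrbit G v (polyAct (h : V ≃ₗ[ℂ] V) s) g = evalOrbit G v s (h⁻¹ * g) := by
  rw [evalOrbit_apply, evalAt_polyAct, evalOrbit_apply]
  rfl

theorem evalAt_apply_of_mem {r : PolyAlg V} (hr : r ∈ invariantAlg G) {g : V ≃ₗ[ℂ] V} (hg : g ∈ G)
    (v : V) : evalAt (g v) r = evalAt v r := by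
  have h1 := evalAt_polyAct g (g v) r
  rw [hr g hg] at h1
  exact h1.trans (congrArg (fun w => evalAt w r) (g.symm_apply_apply v))

theorem evalOrbit_mul {r : PolyAlg V} (hr : r ∈ invariantAlg G) (v : V) (s : PolyAlg V) :
    evalOrbit G v (r * s) = evalAt v r • evalOrbit G v s := by
  funext g
  rw [Pi.smul_apply, evalOrbit_apply, evalOrbit_apply, map_mul, smul_eq_mul,
    evalAt_apply_of_mem hr g.2]

/-- Evaluations at the distinct points of the orbit are distinct characters of `ℂ[V]`, hence
linearly independent. -/
theorem evalOrbit_surjective [Fintype G] {v : V} (hv : ∀ g ∈ G, g v = v → g = 1) :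
    Function.Surjective (evalOrbit G v) := by
  classical
  rw [← LinearMap.range_eq_top]
  by_contra hne
  obtain ⟨φ, hφ0, hφ⟩ := Submodule.exists_le_ker_of_lt_top _ (lt_top_iff_ne_top.2 hne)
  have h1 := (linearIndependent_monoidHom (PolyAlg V) ℂ).comp
    (fun g : G => ((evalAt ((g : V ≃ₗ[ℂ] V) v) : PolyAlg V →ₐ[ℂ] ℂ) : PolyAlg V →* ℂ))
    (fun g h hgh => by
      have h2 : (g : V ≃ₗ[ℂ] V) v = (h : V ≃ₗ[ℂ] V) v := eq_of_dual_eq fun l => by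
        have := DFunLike.congr_fun hgh (SymmetricAlgebra.ι ℂ (Dual ℂ V) l)
        rw [← evalAt_ι, ← evalAt_ι]
        exact this
      have h3 : ((h⁻¹ * g : G) : V ≃ₗ[ℂ] V) v = v := by
        change (h : V ≃ₗ[ℂ] V)⁻¹ ((g : V ≃ₗ[ℂ] V) v) = v
        rw [h2]
        exact (h : V ≃ₗ[ℂ] V).symm_apply_apply v
      exact (inv_mul_eq_one.1 (Subtype.ext (hv _ (SetLike.coe_mem _) h3))).symm)
  rw [Fintype.linearIndependent_iff] at h1
  have h2 := h1 (fun g => φ (Pi.single g 1)) (funext fun s => by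
    have h3 : φ (evalOrbit G v s) = 0 := hφ ⟨s, rfl⟩
    rw [LinearMap.pi_apply_eq_sum_univ] at h3
    rw [Finset.sum_apply, Pi.zero_apply, ← h3]
    refine Finset.sum_congr rfl fun g _ => ?_
    rw [Pi.smul_apply, smul_eq_mul, smul_eq_mul, mul_comm]
    congr 2
    funext x
    simp [Pi.single_apply, eq_comm])
  exact hφ0 (LinearMap.pi_ext' fun g => LinearMap.ext_ring (h2 g))

variable {E : Submodule ℂ (PolyAlg V)}

/-- Invariants are constant on the orbit, so coefficients from the invariants act as scalars and `E`
already realizes all values. -/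
theorem IsGradedComplement.evalOrbit_surjective (hE : IsGradedComplement G E) [Fintype G] {v : V}
    (hv : ∀ g ∈ G, g v = v → g = 1) : Function.Surjective (evalOrbit G v ∘ₗ E.subtype) := by
  have key : ∀ s : PolyAlg V, evalOrbit G v s ∈ LinearMap.range (evalOrbit G v ∘ₗ E.subtype) := by
    intro s
    have hs : s ∈ Submodule.span (invariantAlg G) (E : Set (PolyAlg V)) := by
      rw [hE.span_eq_top]; trivial
    induction hs using Submodule.span_induction with
    | mem x hx => exact ⟨⟨x, hx⟩, rfl⟩
    | zero => rw [map_zero]; exact zero_mem _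
    | add x y _ _ hx hy => rw [map_add]; exact add_mem hx hy
    | smul r x _ hx =>
      change evalOrbit G v ((r : PolyAlg V) * x) ∈ _
      rw [evalOrbit_mul r.2]
      exact Submodule.smul_mem _ _ hx
  intro y
  obtain ⟨s, rfl⟩ := CST.evalOrbit_surjective hv y
  exact key s

/-- A graded complement of the Hilbert ideal carries the regular representation, and its bases are
bases of `ℂ[V]` over the invariants. -/
theorem IsGradedComplement.exists_regular_basis (hE : IsGradedComplement G E)
    (hG : IsComplexReflectionGroup G) :
    finrank ℂ E = Nat.card G ∧ FiniteDimensional ℂ E ∧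
    ∃ b : Basis G ℂ E, ∀ h g : G,
      polyAct (h : V ≃ₗ[ℂ] V) (b g : PolyAlg V) = (b (h * g) : PolyAlg V) := by
  classical
  have := hG.finite
  have := Fintype.ofFinite G
  obtain ⟨κ, e, ε, he⟩ := hE.exists_homogeneous_basis
  have hli := hE.linearIndependent hG e he
  have hfin : Finite κ := by
    by_contra hinf
    rw [not_finite_iff_infinite] at hinf
    have h1 := card_le_of_linearIndependent (hli.comp
      (fun i : Fin (Fintype.card G + 1) => Infinite.natEmbedding κ i)
      ((Infinite.natEmbedding κ).injective.comp Fin.val_injective))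
    rw [Fintype.card_fin] at h1
    omega
  have := Fintype.ofFinite κ
  have hfd : FiniteDimensional ℂ E := e.finiteDimensional_of_finite
  have hle : finrank ℂ E ≤ finrank ℂ (G → ℂ) := by
    rw [finrank_eq_card_basis e, finrank_pi]
    exact card_le_of_linearIndependent hli
  obtain ⟨v, hv⟩ := exists_trivial_stabilizer G
  have hsurj := hE.evalOrbit_surjective hv
  have heq : finrank ℂ E = finrank ℂ (G → ℂ) :=
    le_antisymm hle (LinearMap.finrank_le_finrank_of_surjective hsurj)
  have hinj := (LinearMap.injective_iff_surjective_of_finrank_eq_finrank heq).2 hsurj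
  let Ψ := LinearEquiv.ofBijective (evalOrbit G v ∘ₗ E.subtype) ⟨hinj, hsurj⟩
  have hΨ : ∀ x : E, Ψ x = evalOrbit G v x := fun x => rfl
  refine ⟨by rw [heq, finrank_pi, Nat.card_eq_fintype_card], hfd,
    (Pi.basisFun ℂ G).map Ψ.symm, fun h g => ?_⟩
  have hmem := hE.stable h h.2 _ (SetLike.coe_mem ((Pi.basisFun ℂ G).map Ψ.symm g))
  suffices H : (⟨_, hmem⟩ : E) = (Pi.basisFun ℂ G).map Ψ.symm (h * g) from congrArg Subtype.val H
  apply Ψ.injective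
  rw [hΨ]
  funext x
  rw [evalOrbit_polyAct, ← hΨ]
  simp only [Basis.map_apply, LinearEquiv.apply_symm_apply, Pi.basisFun_apply, Pi.single_apply,
    inv_mul_eq_iff_eq_mul]

/-- Every basis of a graded complement of the Hilbert ideal is a basis of `ℂ[V]` over the
invariants. -/
theorem IsGradedComplement.exists_basis (hE : IsGradedComplement G E)
    (hG : IsComplexReflectionGroup G) {κ : Type*} (b : Basis κ ℂ E) :
    ∃ B : Basis κ (invariantAlg G) (PolyAlg V), ∀ j, B j = b j := by
  obtain ⟨κ', e, ε, he⟩ := hE.exists_homogeneous_basis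
  obtain ⟨-, hfd, -⟩ := hE.exists_regular_basis hG
  have : Finite κ' := Module.Finite.finite_basis e
  have := Fintype.ofFinite κ'
  have : Finite κ := Module.Finite.finite_basis b
  have := Fintype.ofFinite κ
  let B' : Basis κ' (invariantAlg G) (PolyAlg V) :=
    Basis.mk (hE.linearIndependent hG e he) (hE.span_range_basis e).ge
  have := Module.Finite.of_basis B'
  -- The basis `b` need not be homogeneous, so independence comes from spanning with as many
  -- elements as the rank.
  have h1 : Fintype.card κ = finrank (invariantAlg G) (PolyAlg V) := by
    rw [finrank_eq_card_basis B', ← finrank_eq_card_basis e, finrank_eq_card_basis b]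
  exact ⟨Basis.mk (linearIndependent_of_top_le_span_of_card_eq_finrank
    (hE.span_range_basis b).ge h1) (hE.span_range_basis b).ge, fun j => Basis.mk_apply _ _ j⟩

/-! ### Equivariant maps -/

/-- The finite orbit of a nonzero vector spans a nonzero subrepresentation. -/
theorem finiteDimensional_of_isIrreducible {H W : Type*} [Group H] [Finite H] [AddCommGroup W]
    [Module ℂ W] {ρ : Representation ℂ H W} (hρ : ρ.IsIrreducible) : FiniteDimensional ℂ W := by
  by_cases hW : ∀ w : W, w = 0
  · have : Subsingleton W := ⟨fun a b => by rw [hW a, hW b]⟩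
    infer_instance
  push Not at hW
  obtain ⟨w, hw⟩ := hW
  let P : Subrepresentation ρ := ⟨Submodule.span ℂ (Set.range fun g => ρ g w), fun g x hx => by
    induction hx using Submodule.span_induction with
    | mem x hx =>
      obtain ⟨h, rfl⟩ := hx
      exact Submodule.subset_span ⟨g * h, by simp⟩
    | zero => rw [map_zero]; exact zero_mem _
    | add x y _ _ hx hy => rw [map_add]; exact add_mem hx hy
    | smul c x _ hx => rw [map_smul]; exact Submodule.smul_mem _ _ hx⟩
  have hP : P = ⊤ := by
    refine (hρ.eq_bot_or_eq_top P).resolve_left fun h => hw ?_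
    have h1 : w ∈ P.toSubmodule := Submodule.subset_span ⟨1, by simp⟩
    rw [h] at h1
    exact h1
  have h2 : Submodule.span ℂ (Set.range fun g => ρ g w) = ⊤ :=
    congrArg Subrepresentation.toSubmodule hP
  exact ⟨h2 ▸ Submodule.fg_span (Set.finite_range _)⟩

section Equivariant

variable {B : Basis G (invariantAlg G) (PolyAlg V)} {W : Type*} [AddCommGroup W] [Module ℂ W]
  (ρ : Representation ℂ G W)

variable (B) in
/-- The coefficient at `1` of an equivariant map, with respect to a basis permuted by `G`. -/
def equivariantCoeff : equivariantHom G ρ →ₗ[invariantAlg G] (W →ₗ[ℂ] invariantAlg G) where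
  toFun φ := (B.coord 1).restrictScalars ℂ ∘ₗ φ.1
  map_add' φ ψ := by ext w; simp
  map_smul' r φ := by ext w; simp

variable (B) in
theorem equivariantCoeff_apply (φ : equivariantHom G ρ) (w : W) :
    equivariantCoeff B ρ φ w = B.repr (φ.1 w) 1 := rfl

variable [Fintype G]

theorem repr_polyAct (hB : ∀ h g : G, polyAct (h : V ≃ₗ[ℂ] V) (B g) = B (h * g)) (h g : G)
    (s : PolyAlg V) : B.repr (polyAct (h : V ≃ₗ[ℂ] V) s) g = B.repr s (h⁻¹ * g) := by
  classical
  have h1 : polyAct (h : V ≃ₗ[ℂ] V) s = ∑ x, B.repr s (h⁻¹ * x) • B x := by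
    conv_lhs => rw [← B.sum_repr s]
    rw [map_sum, ← Equiv.sum_comp (Equiv.mulLeft h) fun x => B.repr s (h⁻¹ * x) • B x]
    refine Finset.sum_congr rfl fun x _ => ?_
    rw [Equiv.coe_mulLeft, inv_mul_cancel_left, ← hB, Subalgebra.smul_def, Subalgebra.smul_def,
      smul_eq_mul, smul_eq_mul, map_mul, (B.repr s x).2 h h.2]
  rw [h1, B.repr_sum_self]

/-- Frobenius reciprocity: by equivariance the coefficient of `φ w` at `g` is the coefficient of `φ
(g⁻¹ w)` at `1`, which may be any linear function with values in the invariants. -/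
theorem equivariantCoeff_bijective (hB : ∀ h g : G, polyAct (h : V ≃ₗ[ℂ] V) (B g) = B (h * g)) :
    Function.Bijective (equivariantCoeff B ρ) := by
  constructor
  · refine (injective_iff_map_eq_zero _).2 fun φ hφ => Subtype.ext (LinearMap.ext fun w => ?_)
    apply B.repr.injective
    ext g : 1
    have h1 := LinearMap.congr_fun hφ (ρ g⁻¹ w)
    rw [equivariantCoeff_apply, φ.2 g⁻¹ w] at h1
    have h2 := repr_polyAct hB g⁻¹ 1 (φ.1 w)
    rw [inv_inv, mul_one] at h2
    rw [← h2]
    exact h1.trans (by simp)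
  · intro ψ
    let φ : W →ₗ[ℂ] PolyAlg V := ∑ g : G,
      ((LinearMap.toSpanSingleton (invariantAlg G) (PolyAlg V) (B g)).restrictScalars ℂ) ∘ₗ ψ ∘ₗ
        ρ g⁻¹
    have hφ : ∀ w, φ w = ∑ g : G, ψ (ρ g⁻¹ w) • B g := fun w => by simp [φ]
    have hφ' : ∀ w g, B.repr (φ w) g = ψ (ρ g⁻¹ w) := fun w g => by
      rw [hφ, B.repr_sum_self]
    refine ⟨⟨φ, fun g w => ?_⟩, LinearMap.ext fun w => ?_⟩
    · apply B.repr.injective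
      ext x : 1
      change _ = B.repr (polyAct (g : V ≃ₗ[ℂ] V) (φ w)) x
      rw [repr_polyAct hB, hφ', hφ', ← Module.End.mul_apply, ← map_mul, mul_inv_rev, inv_inv]
    · rw [equivariantCoeff_apply, hφ']
      simp

end Equivariant

theorem IsComplexReflectionGroup.equivariantHom_free (hG : IsComplexReflectionGroup G) {W : Type*}
    [AddCommGroup W] [Module ℂ W] (ρ : Representation ℂ G W) (hρ : ρ.IsIrreducible) :
    Module.Free (invariantAlg G) (equivariantHom G ρ) ∧
      Module.Finite (invariantAlg G) (equivariantHom G ρ) ∧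
      finrank (invariantAlg G) (equivariantHom G ρ) = finrank ℂ W := by
  have := hG.finite
  have := Fintype.ofFinite G
  have := finiteDimensional_of_isIrreducible hρ
  obtain ⟨E, hE⟩ := exists_isGradedComplement G
  obtain ⟨-, -, b, hb⟩ := hE.exists_regular_basis hG
  obtain ⟨B, hB⟩ := hE.exists_basis hG b
  let c : Basis (Fin (finrank ℂ W)) (invariantAlg G) (equivariantHom G ρ) :=
    Basis.ofEquivFun ((LinearEquiv.ofBijective (equivariantCoeff B ρ)
      (equivariantCoeff_bijective ρ fun h g => by rw [hB, hB, hb])).trans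
      ((finBasis ℂ W).constr (invariantAlg G)).symm)
  exact ⟨Module.Free.of_basis c, Module.Finite.of_basis c, by
    rw [finrank_eq_card_basis c, Fintype.card_fin]⟩

/-! ### The coinvariant algebra -/

/-- A graded complement of the Hilbert ideal is isomorphic to the coinvariant algebra. -/
def coinvEquiv (hE : IsGradedComplement G E) {n : ℕ} {f : Fin n → PolyAlg V}
    {d : Fin n → ℕ} (h : IsBasicInvariants G f d) : E ≃ₗ[ℂ] Coinv f :=
  (Submodule.quotientEquivOfIsCompl ((Ideal.span (Set.range f)).restrictScalars ℂ) E
    (by rw [h.span_eq]; exact hE.isCompl.symm)).symm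

theorem coinvEquiv_apply (hE : IsGradedComplement G E) {n : ℕ} {f : Fin n → PolyAlg V}
    {d : Fin n → ℕ} (h : IsBasicInvariants G f d) (x : E) :
    coinvEquiv hE h x = Ideal.Quotient.mk (Ideal.span (Set.range f)) (x : PolyAlg V) := rfl

theorem IsComplexReflectionGroup.coinvRep_equiv (hG : IsComplexReflectionGroup G) {n : ℕ}
    {f : Fin n → PolyAlg V} {d : Fin n → ℕ} (h : IsBasicInvariants G f d) :
    Nonempty ((coinvRep h).Equiv (Representation.leftRegular ℂ G)) := by
  have := hG.finite
  obtain ⟨E, hE⟩ := exists_isGradedComplement G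
  obtain ⟨-, -, b, hb⟩ := hE.exists_regular_basis hG
  let b' : Basis G ℂ (Coinv f) := b.map (coinvEquiv hE h)
  have hb' : ∀ x g : G, coinvRep h x (b' g) = b' (x * g) := fun x g => by
    rw [Basis.map_apply, Basis.map_apply, coinvEquiv_apply, coinvEquiv_apply, ← hb]
    rfl
  refine ⟨Representation.Equiv.mk (b'.repr.trans (MonoidAlgebra.coeffLinearEquiv ℂ).symm)
    fun x => b'.ext fun g => ?_⟩
  have hr : ∀ y, (b'.repr.trans (MonoidAlgebra.coeffLinearEquiv ℂ).symm) (b' y) =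
      MonoidAlgebra.single y (1 : ℂ) := fun y => by
    rw [LinearEquiv.trans_apply, b'.repr_self]
    rfl
  change (b'.repr.trans (MonoidAlgebra.coeffLinearEquiv ℂ).symm) (coinvRep h x (b' g)) =
    Representation.leftRegular ℂ G x ((b'.repr.trans (MonoidAlgebra.coeffLinearEquiv ℂ).symm) (b' g))
  rw [hb', hr, hr, Representation.ofMulAction_single, smul_eq_mul]

end

/-! ### Counting by degree -/

section Counting

variable {T : Type*}

/-- The generating function of the numbers of elements of given degree. -/
def countSeries (deg : T → ℕ) : PowerSeries ℤ :=
  PowerSeries.mk fun N => (Nat.card {t // deg t = N} : ℤ)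

theorem countSeries_congr {T' : Type*} {deg : T → ℕ} {deg' : T' → ℕ} (e : T ≃ T')
    (h : ∀ t, deg' (e t) = deg t) : countSeries deg = countSeries deg' := by
  ext N
  rw [countSeries, countSeries, PowerSeries.coeff_mk, PowerSeries.coeff_mk,
    Nat.card_congr (e.subtypeEquiv (p := fun t => deg t = N) (q := fun t => deg' t = N)
      fun t => by rw [h])]

/-- `Nat.card` is zero on infinite types, so counting needs finite fibres; this carries finiteness
through the induction on the number of factors. -/
theorem finite_fiber_prod {deg : T → ℕ} (hdeg : ∀ N, Finite {t // deg t = N}) {d : ℕ} (hd : 0 < d)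
    (N : ℕ) : Finite {p : T × ℕ // deg p.1 + d * p.2 = N} := by
  refine Finite.of_injective (β := (Σ M : Fin (N + 1), {t // deg t = M}) × Fin (N + 1))
    (fun p => (⟨⟨deg p.1.1, by have := p.2; omega⟩, p.1.1, rfl⟩,
      ⟨p.1.2, by have := p.2; have := Nat.le_mul_of_pos_left p.1.2 hd; omega⟩)) ?_
  rintro ⟨⟨t, k⟩, h⟩ ⟨⟨t', k'⟩, h'⟩ heq
  simp only [Prod.mk.injEq, Fin.mk.injEq] at heq
  obtain ⟨h1, rfl⟩ := heq
  have : t = t' := by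
    have h2 := congrArg (fun x : Σ M : Fin (N + 1), {t // deg t = M} => x.2.1) h1
    exact h2
  subst this
  rfl

/-- Pairs of degree `N` have second component zero or come from a pair of degree `N - d`. -/
def fiberProdEquiv (deg : T → ℕ) (d N : ℕ) :
    {p : T × ℕ // deg p.1 + d * p.2 = N} ≃
      {t // deg t = N} ⊕ {p : T × ℕ // deg p.1 + d * p.2 + d = N} where
  toFun
    | ⟨(t, 0), h⟩ => Sum.inl ⟨t, by simpa using h⟩
    | ⟨(t, k + 1), h⟩ => Sum.inr ⟨(t, k), by rw [← h, mul_add, mul_one, add_assoc]⟩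
  invFun
    | Sum.inl t => ⟨(t.1, 0), by simpa using t.2⟩
    | Sum.inr p => ⟨(p.1.1, p.1.2 + 1), by
        have := p.2
        dsimp only
        rw [mul_add, mul_one, ← add_assoc]
        exact this⟩
  left_inv := by rintro ⟨⟨t, _ | k⟩, h⟩ <;> rfl
  right_inv := by rintro (⟨t, h⟩ | ⟨⟨t, k⟩, h⟩) <;> rfl

theorem countSeries_prod {deg : T → ℕ} (hdeg : ∀ N, Finite {t // deg t = N}) {d : ℕ} (hd : 0 < d) :
    (1 - PowerSeries.X ^ d) * countSeries (fun p : T × ℕ => deg p.1 + d * p.2) =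
      countSeries deg := by
  ext N
  have hfin := finite_fiber_prod hdeg hd
  have hfin' : Finite {p : T × ℕ // deg p.1 + d * p.2 + d = N} :=
    Finite.of_injective (β := {p : T × ℕ // deg p.1 + d * p.2 = N - d})
      (fun p => ⟨p.1, by have := p.2; omega⟩)
      fun p q h => Subtype.ext (Subtype.mk.inj h)
  have := hdeg N
  rw [sub_mul, one_mul, map_sub, PowerSeries.coeff_X_pow_mul', countSeries, countSeries,
    PowerSeries.coeff_mk, PowerSeries.coeff_mk, PowerSeries.coeff_mk,
    Nat.card_congr (fiberProdEquiv deg d N), Nat.card_sum, Nat.cast_add]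
  split_ifs with h
  · rw [Nat.card_congr (Equiv.subtypeEquivRight fun p : T × ℕ =>
      (by omega : deg p.1 + d * p.2 + d = N ↔ deg p.1 + d * p.2 = N - d)), add_sub_cancel_right]
  · have : IsEmpty {p : T × ℕ // deg p.1 + d * p.2 + d = N} := ⟨fun p => by have := p.2; omega⟩
    rw [Nat.card_of_isEmpty (α := {p : T × ℕ // deg p.1 + d * p.2 + d = N}), Nat.cast_zero,
      add_zero, sub_zero]

theorem countSeries_prod_pi {n : ℕ} : ∀ {T : Type*} {deg : T → ℕ}, (∀ N, Finite {t // deg t = N}) →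
    ∀ {d : Fin n → ℕ}, (∀ i, 0 < d i) →
    (∏ i, (1 - PowerSeries.X ^ d i)) *
      countSeries (fun p : T × (Fin n → ℕ) => deg p.1 + ∑ i, d i * p.2 i) = countSeries deg := by
  induction n with
  | zero =>
    intro T deg _ d _
    rw [Fin.prod_univ_zero, one_mul]
    exact countSeries_congr (Equiv.prodUnique T (Fin 0 → ℕ)) fun p => by simp
  | succ n ih =>
    intro T deg hdeg d hd
    rw [Fin.prod_univ_succ, mul_assoc, ← countSeries_prod hdeg (hd 0),
      ← ih (finite_fiber_prod hdeg (hd 0)) fun i => hd i.succ]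
    congr 2
    refine countSeries_congr (((Equiv.refl T).prodCongr
      (Fin.consEquiv fun _ : Fin (n + 1) => ℕ).symm).trans (Equiv.prodAssoc T ℕ _).symm) fun p => ?_
    simp [Fin.sum_univ_succ, add_assoc, Fin.consEquiv, Fin.tail]

theorem countSeries_eq_coe [Fintype T] (deg : T → ℕ) :
    countSeries deg = ((∑ t, X ^ deg t : ℤ[X]) : PowerSeries ℤ) := by
  ext N
  rw [countSeries, PowerSeries.coeff_mk, Polynomial.coeff_coe, Polynomial.finsetSum_coeff]
  simp only [Polynomial.coeff_X_pow, Finset.sum_boole]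
  rw [Nat.card_eq_fintype_card, Fintype.card_subtype]
  simp only [eq_comm]

theorem qInt_mul (d : ℕ) : qInt d * (1 - X) = 1 - X ^ d := by
  rw [qInt, ← neg_sub X 1, mul_neg, geom_sum_mul, neg_sub]

end Counting

variable {V : Type u} [AddCommGroup V] [Module ℂ V] {G : Subgroup (V ≃ₗ[ℂ] V)}

/-! ### The Hilbert series -/

theorem finrank_span_eq_natCard {ι M : Type*} [AddCommGroup M] [Module ℂ M] {v : ι → M}
    (hv : LinearIndependent ℂ v) : finrank ℂ (Submodule.span ℂ (Set.range v)) = Nat.card ι :=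
  finrank_eq_nat_card_basis (Basis.span hv)

theorem comp_mem_span_fiber {κ : Type*} {v : κ → PolyAlg V} {ε : κ → ℕ}
    (hv : ∀ j, v j ∈ homogeneousPart V (ε j)) {x : PolyAlg V}
    (hx : x ∈ Submodule.span ℂ (Set.range v)) (N : ℕ) :
    comp N x ∈ Submodule.span ℂ (Set.range fun j : {j // ε j = N} => v j) := by
  induction hx using Submodule.span_induction with
  | mem x hx =>
    obtain ⟨j, rfl⟩ := hx
    by_cases h : ε j = N
    · rw [comp_of_mem (h ▸ hv j)]
      exact Submodule.subset_span ⟨⟨j, h⟩, rfl⟩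
    · rw [comp_of_mem_of_ne (hv j) h]
      exact zero_mem _
  | zero => rw [map_zero]; exact zero_mem _
  | add x y _ _ hx hy => rw [map_add]; exact add_mem hx hy
  | smul c x _ hx => rw [map_smul]; exact Submodule.smul_mem _ _ hx

theorem finrank_homogeneousPart {κ : Type*} (b : Basis κ ℂ (PolyAlg V)) {ε : κ → ℕ}
    (hb : ∀ j, b j ∈ homogeneousPart V (ε j)) (N : ℕ) :
    finrank ℂ (homogeneousPart V N) = Nat.card {j // ε j = N} := by
  have h1 : homogeneousPart V N = Submodule.span ℂ (Set.range fun j : {j // ε j = N} => b j) := by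
    apply le_antisymm
    · intro x hx
      rw [← comp_of_mem hx]
      exact comp_mem_span_fiber hb (by rw [b.span_eq]; trivial) N
    · rw [Submodule.span_le]
      rintro _ ⟨⟨j, rfl⟩, rfl⟩
      exact hb j
  rw [h1]
  exact finrank_span_eq_natCard (b.linearIndependent.comp _ Subtype.val_injective)

theorem finrank_coinvPart {E : Submodule ℂ (PolyAlg V)} (hE : IsGradedComplement G E) {n : ℕ}
    {f : Fin n → PolyAlg V} {d : Fin n → ℕ} (h : IsBasicInvariants G f d) {κ : Type*}
    (e : Basis κ ℂ E) {ε : κ → ℕ} (he : ∀ j, (e j : PolyAlg V) ∈ homogeneousPart V (ε j)) (N : ℕ) :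
    finrank ℂ (coinvPart f N) = Nat.card {j // ε j = N} := by
  let π := (Ideal.Quotient.mkₐ ℂ (Ideal.span (Set.range f))).toLinearMap
  have h1 : coinvPart f N =
      Submodule.span ℂ (Set.range fun j : {j // ε j = N} => e.map (coinvEquiv hE h) j) := by
    have h2 : (Set.range fun j : {j // ε j = N} => e.map (coinvEquiv hE h) j) =
        π '' Set.range fun j : {j // ε j = N} => (e j : PolyAlg V) := by
      rw [← Set.range_comp]
      rfl
    rw [h2, ← Submodule.map_span]
    apply le_antisymm
    · rintro _ ⟨x, hx, rfl⟩
      have hx' : x ∈ E ⊔ (hilbertIdeal G).restrictScalars ℂ := by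
        rw [hE.isCompl.sup_eq_top]; trivial
      obtain ⟨a, ha, i, hi, rfl⟩ := Submodule.mem_sup.1 hx'
      refine ⟨comp N a, ?_, ?_⟩
      · refine comp_mem_span_fiber he ?_ N
        have h3 : (⟨a, ha⟩ : E) ∈ Submodule.span ℂ (Set.range e) := by rw [e.span_eq]; trivial
        have h4 := Submodule.mem_map_of_mem (f := E.subtype) h3
        rwa [Submodule.map_span, ← Set.range_comp] at h4
      · rw [← comp_of_mem hx, map_add (comp N), map_add]
        have h5 : π (comp N i) = 0 := by
          refine Ideal.Quotient.eq_zero_iff_mem.2 ?_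
          rw [h.span_eq]
          exact comp_mem_of_mem_hilbertIdeal hi N
        change π _ = π _ + π _
        rw [h5, add_zero]
    · refine Submodule.map_mono (Submodule.span_le.2 ?_)
      rintro _ ⟨⟨j, rfl⟩, rfl⟩
      exact he j
  rw [h1]
  exact finrank_span_eq_natCard
    ((e.map (coinvEquiv hE h)).linearIndependent.comp _ Subtype.val_injective)

variable (V) in
/-- The Hilbert series of `ℂ[V]`. -/
def polySeries : PowerSeries ℤ := PowerSeries.mk fun N => (finrank ℂ (homogeneousPart V N) : ℤ)

theorem polySeries_eq {κ : Type*} (b : Basis κ ℂ (PolyAlg V)) {ε : κ → ℕ}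
    (hb : ∀ j, b j ∈ homogeneousPart V (ε j)) : polySeries V = countSeries ε := by
  ext N
  rw [polySeries, countSeries, PowerSeries.coeff_mk, PowerSeries.coeff_mk,
    finrank_homogeneousPart b hb]

theorem weight_eq_sum {n : ℕ} (d : Fin n → ℕ) (m : Fin n →₀ ℕ) :
    Finsupp.weight d m = ∑ i, d i * m i := by
  rw [Finsupp.weight_apply, Finsupp.sum_fintype _ _ (by simp)]
  simp [mul_comm]

/-- The Hilbert series of `ℂ[V]` in terms of a homogeneous basis over the invariants. -/
theorem IsBasicInvariants.prod_mul_polySeries {n : ℕ} {f : Fin n → PolyAlg V} {d : Fin n → ℕ}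
    (h : IsBasicInvariants G f d) {κ : Type*} [Finite κ]
    (B : Basis κ (invariantAlg G) (PolyAlg V)) {ε : κ → ℕ}
    (hB : ∀ j, B j ∈ homogeneousPart V (ε j)) :
    (∏ i, (1 - PowerSeries.X ^ d i)) * polySeries V = countSeries ε := by
  -- Monomials in the basic invariants times the elements of `B` form a homogeneous complex basis of
  -- `ℂ[V]`.
  let c : Basis (Fin n →₀ ℕ) ℂ (invariantAlg G) :=
    (MvPolynomial.basisMonomials (Fin n) ℂ).map (h.algebraicIndependent.aevalEquiv.trans
      (Subalgebra.equivOfEq _ _ h.adjoin_eq)).toLinearEquiv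
  have hc : ∀ m, (c m : PolyAlg V) = MvPolynomial.aeval f (MvPolynomial.monomial m (1 : ℂ)) :=
    fun m => by
      rw [Basis.map_apply, MvPolynomial.coe_basisMonomials]
      exact h.algebraicIndependent.algebraMap_aevalEquiv _
  have hb : ∀ p : (Fin n →₀ ℕ) × κ,
      c.smulTower B p ∈ homogeneousPart V (Finsupp.weight d p.1 + ε p.2) := fun p => by
    rw [Basis.smulTower_apply, Subalgebra.smul_def, smul_eq_mul, hc]
    exact mul_mem_homogeneousPart (aeval_monomial_mem h.homogeneous _ _) (hB _)
  rw [polySeries_eq _ hb, ← countSeries_prod_pi (deg := ε) (fun N => inferInstance) h.degree_pos]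
  congr 1
  refine countSeries_congr ((Equiv.prodComm (Fin n →₀ ℕ) κ).trans
    ((Equiv.refl κ).prodCongr Finsupp.equivFunOnFinite)) fun p => ?_
  rw [weight_eq_sum, add_comm (∑ i, d i * p.1 i)]
  rfl

theorem pow_mul_polySeries [FiniteDimensional ℂ V] :
    (1 - PowerSeries.X) ^ finrank ℂ V * polySeries V = 1 := by
  let b : Basis (Fin (finrank ℂ V) →₀ ℕ) ℂ (PolyAlg V) :=
    (MvPolynomial.basisMonomials (Fin (finrank ℂ V)) ℂ).map (polyEquiv V).symm.toLinearEquiv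
  have hb : ∀ m, b m ∈ homogeneousPart V (Finsupp.weight (fun _ => 1) m) := fun m => by
    rw [mem_homogeneousPart_iff, Basis.map_apply, MvPolynomial.coe_basisMonomials]
    change (polyEquiv V ((polyEquiv V).symm _)).IsHomogeneous _
    rw [AlgEquiv.apply_symm_apply]
    exact MvPolynomial.isWeightedHomogeneous_monomial _ _ _ rfl
  have h1 : countSeries (fun _ : Unit => 0) = 1 := by
    rw [countSeries_eq_coe]; simp
  have h2 := countSeries_prod_pi (n := finrank ℂ V) (deg := fun _ : Unit => 0)
    (fun N => inferInstance) (d := fun _ => 1) fun _ => one_pos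
  rw [Finset.prod_const, Finset.card_univ, Fintype.card_fin, pow_one, h1] at h2
  rw [polySeries_eq b hb]
  refine Eq.trans ?_ h2
  congr 1
  refine countSeries_congr ((Equiv.punitProd (Fin (finrank ℂ V) →₀ ℕ)).symm.trans
    ((Equiv.refl Unit).prodCongr Finsupp.equivFunOnFinite)) fun m => ?_
  rw [weight_eq_sum, zero_add]
  rfl

theorem IsComplexReflectionGroup.hilbertSeries_eq [FiniteDimensional ℂ V]
    (hG : IsComplexReflectionGroup G) {f : Fin (finrank ℂ V) → PolyAlg V}
    {d : Fin (finrank ℂ V) → ℕ} (h : IsBasicInvariants G f d) :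
    ∏ i, d i = Nat.card G ∧
      hilbertSeries f = ((∏ i, qInt (d i) : ℤ[X]) : PowerSeries ℤ) := by
  have := hG.finite
  obtain ⟨E, hE⟩ := exists_isGradedComplement G
  obtain ⟨hcard, hfd, -⟩ := hE.exists_regular_basis hG
  obtain ⟨κ, e, ε, he⟩ := hE.exists_homogeneous_basis
  have : Finite κ := Module.Finite.finite_basis e
  have := Fintype.ofFinite κ
  obtain ⟨B, hB⟩ := hE.exists_basis hG e
  have h1 := h.prod_mul_polySeries B (ε := ε) fun j => by rw [hB]; exact he j
  have h2 : hilbertSeries f = countSeries ε := by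
    ext N
    rw [hilbertSeries, countSeries, PowerSeries.coeff_mk, PowerSeries.coeff_mk,
      finrank_coinvPart hE h e he]
  have h3 : (∏ i, (1 - PowerSeries.X ^ d i) : PowerSeries ℤ) =
      ((∏ i, qInt (d i) : ℤ[X]) : PowerSeries ℤ) * (1 - PowerSeries.X) ^ finrank ℂ V := by
    have h4 : ∏ i, (1 - X ^ d i : ℤ[X]) = (∏ i, qInt (d i)) * (1 - X) ^ finrank ℂ V := by
      simp only [← qInt_mul, Finset.prod_mul_distrib, Finset.prod_const, Finset.card_univ,
        Fintype.card_fin]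
    have h5 := congrArg (Polynomial.coeToPowerSeries.ringHom (R := ℤ)) h4
    rw [← Polynomial.coeToPowerSeries.ringHom_apply]
    simpa only [map_prod, map_mul, map_pow, map_sub, map_one,
      Polynomial.coeToPowerSeries.ringHom_apply, Polynomial.coe_X] using h5
  have h4 : hilbertSeries f = ((∏ i, qInt (d i) : ℤ[X]) : PowerSeries ℤ) := by
    rw [h2, ← h1, h3, mul_assoc, pow_mul_polySeries, mul_one]
  refine ⟨?_, h4⟩
  -- An identity of polynomials, unlike one of power series, may be evaluated at `1`: the left side
  -- becomes `dim E = |G|`, the right side `∏ d i`.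
  have h5 : (∑ j, X ^ ε j : ℤ[X]) = ∏ i, qInt (d i) := by
    apply Polynomial.coe_injective
    rw [← countSeries_eq_coe, ← h2, h4]
  have h6 := congrArg (Polynomial.eval 1) h5
  simp only [Polynomial.eval_finsetSum, Polynomial.eval_pow, Polynomial.eval_X, one_pow,
    Polynomial.eval_prod, qInt, Finset.sum_const, Finset.card_univ, Finset.card_range,
    nsmul_eq_mul, mul_one] at h6
  rw [← hcard, finrank_eq_card_basis e]
  exact_mod_cast h6.symm

end CST

end

theorem mainTheorem8 {V : Type*} [AddCommGroup V] [Module ℂ V] [FiniteDimensional ℂ V]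
    (G : Subgroup (V ≃ₗ[ℂ] V)) (hG : CST.IsComplexReflectionGroup G) :
    (∀ (W : Type*) [AddCommGroup W] [Module ℂ W] (ρ : Representation ℂ G W),
      ρ.IsIrreducible →
        Module.Free (CST.invariantAlg G) (CST.equivariantHom G ρ) ∧
        Module.Finite (CST.invariantAlg G) (CST.equivariantHom G ρ) ∧
        Module.finrank (CST.invariantAlg G) (CST.equivariantHom G ρ) = Module.finrank ℂ W) ∧
    (∃ (f : Fin (Module.finrank ℂ V) → CST.PolyAlg V) (d : Fin (Module.finrank ℂ V) → ℕ),
      CST.IsBasicInvariants G f d) ∧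
    (∀ (f : Fin (Module.finrank ℂ V) → CST.PolyAlg V) (d : Fin (Module.finrank ℂ V) → ℕ)
      (h : CST.IsBasicInvariants G f d),
        Nonempty ((CST.coinvRep h).Equiv (Representation.leftRegular ℂ G)) ∧
        ∏ i, d i = Nat.card G ∧
        CST.hilbertSeries f = ((∏ i, CST.qInt (d i) : Polynomial ℤ) : PowerSeries ℤ)) :=
  ⟨fun _ _ _ ρ hρ => hG.equivariantHom_free ρ hρ, hG.exists_isBasicInvariants,
    fun _ _ h => ⟨hG.coinvRep_equiv h, hG.hilbertSeries_eq h⟩⟩
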